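/- Let $F_t : (\mathbb{C}^n,0)\to(\mathbb{C},0)$, $t\in U$, be an analytic family of function germs, where $U\subset\mathbb{C}$ is open and connected. The family is called \emph{Lipschitz trivial over $U$} if for each $t_0\in U$ there are a neighborhood $U_{t_0}\subset U$ of $t_0$ and a continuous family of germs of bi-Lipschitz homeomorphisms $h_t:(\mathbb{C}^n,0)\to(\mathbb{C}^n,0)$, $t\in U_{t_0}$, such that $F_t(h_t(x))=F_{t_0}(x)$ for all $x$ in a neighborhood of $0\in\mathbb{C}^n$ (independent of $t$, on which all the $h_t$ are defined and bi-Lipschitz) and all $t\in U_{t_0}$. \textbf{Theorem.} For each fixed $s\in\mathbb{C}$ (and each fixed integer $q$ in (9), (10)) satisfying the stated restriction, the following families of germs at the origin of $\mathbb{C}^2$, with parameter $t\in\mathbb{C}$, are Lipschitz trivial over $\mathbb{C}$: \begin{enumerate} \item $Z_{1,0}$: $x^3y+sx^2y^3+txy^6+y^7$, $\;4s^3+27\neq 0$; \item $Z_{1,1}$: $x^3y+x^2y^3+sy^8+ty^9$, $\;s\neq 0$; \item $Z_{17}$: $x^3y+y^8+sxy^6+txy^7$, $\;s\neq 0$; \item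 $W_{1,0}$: $x^4+sx^2y^3+tx^2y^4+y^6$, $\;s^2\neq 4$; \item $W_{1,1}$: $x^4+x^2y^3+sy^7+ty^8$, $\;s\neq 0$; \item $W_{1,2}$: $x^4+x^2y^3+sy^8+ty^9$, $\;s\neq 0$; \item $W_{17}$: $x^4+xy^5+sy^7+ty^8$, $\;s\neq 0$; \item $W_{18}$: $x^4+y^7+sx^2y^4+tx^2y^5$, $\;s\neq 0$; \item $W^{\#}_{1,2q-1}$: $(x^2+y^3)^2+sxy^{4+q}+txy^{5+q}$, $\;s\neq 0$, $q>0$; \item $W^{\#}_{1,2q}$: $(x^2+y^3)^2+sx^2y^{3+q}+tx^2y^{4+q}$, $\;s\neq 0$, $q>0$. \end{enumerate} -/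

import Mathlib

open Set

namespace LipschitzTriviality

/-- `φ` is a bi-Lipschitz map on `W`: distances are preserved up to positive factors. -/
def IsBiLipschitzOn {E : Type*} [NormedAddCommGroup E] (φ : E → E) (W : Set E) : Prop :=
  ∃ c C : ℝ, 0 < c ∧ 0 < C ∧
    ∀ x ∈ W, ∀ y ∈ W, c * ‖x - y‖ ≤ ‖φ x - φ y‖ ∧ ‖φ x - φ y‖ ≤ C * ‖x - y‖

/-- A family `F t : (ℂⁿ, 0) → (ℂ, 0)`, `t ∈ U`, is Lipschitz trivial over `U`: for each `t₀ ∈ U`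
there are an open neighbourhood `V ⊆ U` of `t₀`, an open neighbourhood `W` of `0` in `ℂⁿ`, and
maps `h t` (`t ∈ V`), jointly continuous on `V × W`, such that each `h t` fixes `0`, is a
bi-Lipschitz homeomorphism of `W` onto an open set (hence onto a neighbourhood of `0`),
and satisfies `F t ∘ h t = F t₀` on `W`. -/
def IsLipschitzTrivialOver {n : ℕ} (F : ℂ → EuclideanSpace ℂ (Fin n) → ℂ) (U : Set ℂ) : Prop :=
  ∀ t₀ ∈ U, ∃ V : Set ℂ, IsOpen V ∧ t₀ ∈ V ∧ V ⊆ U ∧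
    ∃ W : Set (EuclideanSpace ℂ (Fin n)), IsOpen W ∧ 0 ∈ W ∧
      ∃ h : ℂ → EuclideanSpace ℂ (Fin n) → EuclideanSpace ℂ (Fin n),
        ContinuousOn (fun p : ℂ × EuclideanSpace ℂ (Fin n) => h p.1 p.2) (V ×ˢ W) ∧
        ∀ t ∈ V, h t 0 = 0 ∧ IsBiLipschitzOn (h t) W ∧ IsOpen (h t '' W) ∧
          ∀ x ∈ W, F t (h t x) = F t₀ x

/-- For a function `f t x y` of two variables `x, y` depending on the parameter `t ∈ ℂ`:
the family of germs at the origin of `ℂ²` is Lipschitz trivial with respect to `t`. -/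
def IsLipschitzTrivial (f : ℂ → ℂ → ℂ → ℂ) : Prop :=
  IsLipschitzTrivialOver
    (fun t (z : EuclideanSpace ℂ (Fin 2)) => f t (z 0) (z 1)) univ

/-! The ten families, as polynomials in `x, y` with parameters `s, t`
(in the last two also a natural number `q`). -/

def Z_1_0 (s t x y : ℂ) : ℂ := x ^ 3 * y + s * x ^ 2 * y ^ 3 + t * x * y ^ 6 + y ^ 7

def Z_1_1 (s t x y : ℂ) : ℂ := x ^ 3 * y + x ^ 2 * y ^ 3 + s * y ^ 8 + t * y ^ 9

def Z_17 (s t x y : ℂ) : ℂ := x ^ 3 * y + y ^ 8 + s * x * y ^ 6 + t * x * y ^ 7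

def W_1_0 (s t x y : ℂ) : ℂ := x ^ 4 + s * x ^ 2 * y ^ 3 + t * x ^ 2 * y ^ 4 + y ^ 6

def W_1_1 (s t x y : ℂ) : ℂ := x ^ 4 + x ^ 2 * y ^ 3 + s * y ^ 7 + t * y ^ 8

def W_1_2 (s t x y : ℂ) : ℂ := x ^ 4 + x ^ 2 * y ^ 3 + s * y ^ 8 + t * y ^ 9

def W_17 (s t x y : ℂ) : ℂ := x ^ 4 + x * y ^ 5 + s * y ^ 7 + t * y ^ 8

def W_18 (s t x y : ℂ) : ℂ := x ^ 4 + y ^ 7 + s * x ^ 2 * y ^ 4 + t * x ^ 2 * y ^ 5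

/-- The family `W^#_{1,2q-1}`. -/
def W_sharp_odd (q : ℕ) (s t x y : ℂ) : ℂ :=
  (x ^ 2 + y ^ 3) ^ 2 + s * x * y ^ (4 + q) + t * x * y ^ (5 + q)

/-- The family `W^#_{1,2q}`. -/
def W_sharp_even (q : ℕ) (s t x y : ℂ) : ℂ :=
  (x ^ 2 + y ^ 3) ^ 2 + s * x ^ 2 * y ^ (3 + q) + t * x ^ 2 * y ^ (4 + q)

end LipschitzTriviality

/-!
Each family `f t` is trivialized by the Thom–Levine method: if the equation
`∂f/∂t + A ∂f/∂x + B ∂f/∂y = 0` has solutions `A`, `B` that are Lipschitz in `(t, x, y)` near `(t₀, 0, 0)` and vanish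
along `x = y = 0`, then integrating the field `A ∂x + B ∂y` over the segments from `t₀` to `t`
produces bi-Lipschitz homeomorphisms `h t`, jointly continuous in `t`, with `f t ∘ h t = f t₀`
(`isLipschitzTrivialOver_of_vectorField`, `isLipschitzTrivial_of_solution`).

The solution is assembled from a frame of two vector fields `v₁`, `v₂` along which `f` has
derivatives `G₁`, `G₂`, as `-∂f/∂t · (conj G₁ v₁ + conj G₂ v₂) / (|G₁|² + |G₂|²)`. Its Lipschitz
property follows from a calculus of sizes. Given a scale `X`, a function is `Controlled` by `M` if
it is `O(M)` and if its Lipschitz constant between points that are close compared with `X` is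
`O(M / X)`. Controlled functions can be added, multiplied and inverted, and a function controlled by
the scale itself is Lipschitz (`Controlled.exists_lipschitzOnWith`). So only two estimates are
left (`isLipschitzTrivial_of_frame`): `|G₁| + |G₂|` is bounded below by the common upper bound `M`
of `G₁` and `G₂`, and the products of `∂f/∂t` with the coefficients of the frame are controlled by
`M X`.

For weights `m ≥ n` of `x`, `y`, the scale is `X = Nᵐ` with `N = max (|x|^(1/m)) (|y|^(1/n))`.

* For `Z_1_0`, `Z_17`, `W_1_0`, `W_17`, `W_18` the weighted initial form has an isolated critical
  point, so the frame `Nᵐ ∂x`, `Nⁿ ∂y` satisfies the lower bound by homogeneity and compactness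
  (`exists_gauge_lower_bound`, `isLipschitzTrivial_of_weighted`).
* For the `W_sharp` families the initial form `(x² + y³)²` has the cusp as its critical locus. The
  frame is formed by the Euler field, which detects the initial form, and the Hamiltonian field
  `3y² ∂x - 2x ∂y` of the cusp, which annihilates the initial form and whose value on the next
  term does not vanish on the cusp (`isLipschitzTrivial_of_cusp`).
* For `W_1_1`, `W_1_2`, `Z_1_1` the Newton polygon has two edges. The scale `X` belongs to the edge
  next to the `y`-axis, and the frame is `X ∂x`, `Y ∂y` with `Y = ‖(x, y)‖`. The lower bound is an
  inequality between real numbers (`exists_lower_bound_quartic`, `exists_lower_bound_cubic`),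
  obtained by comparing the two edges. For `W_1_2` and `Z_1_1` the term `y⁹ = ∂f/∂t` is too
  large compared with `M X` and is removed beforehand by a smooth vector field proportional to
  `-3/2 xy ∂x + y² ∂y`, which annihilates `x²y³` and maps `y⁸` to `8y⁹`.
-/

namespace LipschitzTriviality

open Filter Topology Metric Asymptotics
open scoped NNReal ComplexConjugate

/-! ### Trivialization by integrating a Lipschitz vector field -/

/-- The flow of a globally Lipschitz time-dependent vector field `θ • V (t₀ + τ θ, ·)`, where the
complex direction `θ` is a parameter. Treating `θ` as part of the initial condition makes
the flow Lipschitz in `(θ, z)` jointly. -/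
theorem exists_radial_flow {E : Type*} [NormedAddCommGroup E] [NormedSpace ℂ E] [CompleteSpace E]
    (t₀ : ℂ) (V : ℂ × E → E) {ρ : ℝ} (hρ : 0 < ρ) {K : ℝ≥0}
    (hV : LipschitzWith K V) (hV0 : ∀ t ∈ ball t₀ ρ, V (t, 0) = 0) :
    ∃ (Φ : ℂ → E → ℝ → E) (r : ℝ) (L : ℝ≥0), 0 < r ∧ r < ρ ∧
      (∀ θ z, ‖θ‖ ≤ r → ‖z‖ ≤ r → Φ θ z 0 = z ∧ ∀ τ ∈ Icc (0 : ℝ) 1,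
        HasDerivWithinAt (Φ θ z) (θ • V (t₀ + τ * θ, Φ θ z τ)) (Icc 0 1) τ) ∧
      (∀ τ ∈ Icc (0 : ℝ) 1, ∀ θ z θ' z', ‖θ‖ ≤ r → ‖z‖ ≤ r → ‖θ'‖ ≤ r → ‖z'‖ ≤ r →
        ‖Φ θ z τ - Φ θ' z' τ‖ ≤ L * ‖((θ, z) : ℂ × E) - (θ', z')‖) := by
  obtain ⟨a, ha0, haρ, haK⟩ : ∃ a : ℝ≥0, 0 < a ∧ (a : ℝ) < ρ ∧ (K : ℝ) * a ≤ 1 / 4 := by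
    have h1 : 0 < min (ρ / 2) (1 / (4 * ((K : ℝ) + 1))) := by positivity
    refine ⟨⟨_, h1.le⟩, h1, ?_, ?_⟩
    · exact lt_of_le_of_lt (min_le_left _ _) (by linarith)
    · refine le_trans (mul_le_mul_of_nonneg_left (min_le_right _ _) K.2) ?_
      have : (0 : ℝ) ≤ K := K.2
      rw [mul_one_div, div_le_iff₀ (by positivity)]
      linarith
  have hball : ∀ τ ∈ Icc (0 : ℝ) 1, ∀ θ : ℂ, ‖θ‖ ≤ a → t₀ + τ * θ ∈ ball t₀ ρ := by
    intro τ hτ θ hθ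
    rw [mem_ball, dist_eq_norm, add_sub_cancel_left, norm_mul, Complex.norm_real,
      Real.norm_of_nonneg hτ.1]
    nlinarith [hτ.2, norm_nonneg θ, hτ.1]
  have hbd : ∀ τ ∈ Icc (0 : ℝ) 1, ∀ θ : ℂ, ∀ z : E, ‖θ‖ ≤ a → ‖V (t₀ + τ * θ, z)‖ ≤ K * ‖z‖ := by
    intro τ hτ θ z hθ
    have := hV.norm_sub_le (t₀ + τ * θ, z) (t₀ + τ * θ, 0)
    rw [hV0 _ (hball τ hτ θ hθ), sub_zero] at this
    simpa [Prod.norm_def] using this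
  let f : ℝ → ℂ × E → ℂ × E := fun τ p => (0, p.1 • V (t₀ + τ * p.1, p.2))
  have hPL : IsPicardLindelof f (tmin := 0) (tmax := 1) ⟨0, by simp⟩ (0 : ℂ × E) a (a / 2)
      (K * a * a) (2 * a * K) := by
    refine ⟨?_, ?_, ?_, ?_⟩
    · intro τ hτ
      refine LipschitzOnWith.of_dist_le_mul fun p hp q hq => ?_
      rw [mem_closedBall_zero_iff] at hp hq
      have hp1 : ‖p.1‖ ≤ a := (norm_fst_le p).trans hp
      have hq1 : ‖q.1‖ ≤ a := (norm_fst_le q).trans hq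
      have hp2 : ‖p.2‖ ≤ a := (norm_snd_le p).trans hp
      have hA : ‖V (t₀ + τ * p.1, p.2)‖ ≤ K * a :=
        (hbd τ hτ _ _ hp1).trans (by gcongr)
      have hB : ‖V (t₀ + τ * p.1, p.2) - V (t₀ + τ * q.1, q.2)‖ ≤ K * ‖p - q‖ := by
        refine (hV.norm_sub_le _ _).trans ?_
        gcongr
        rw [Prod.norm_def, Prod.norm_def]
        refine max_le_max ?_ le_rfl
        have : (t₀ + τ * p.1, p.2).1 - (t₀ + τ * q.1, q.2).1 = τ * (p.1 - q.1) := by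
          simp; ring
        rw [Prod.fst_sub, this, norm_mul, Complex.norm_real, Real.norm_of_nonneg hτ.1]
        exact mul_le_of_le_one_left (norm_nonneg _) hτ.2
      have hC : ‖p.1 - q.1‖ ≤ ‖p - q‖ := norm_fst_le (p - q)
      rw [dist_eq_norm, dist_eq_norm]
      have : f τ p - f τ q = (0, (p.1 - q.1) • V (t₀ + τ * p.1, p.2)
          + q.1 • (V (t₀ + τ * p.1, p.2) - V (t₀ + τ * q.1, q.2))) := by
        simp only [f, Prod.mk_sub_mk, sub_zero, sub_smul, smul_sub]
        congr 1
        abel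
      rw [this, Prod.norm_def]
      refine max_le (by simp; positivity) ?_
      refine (norm_add_le _ _).trans ?_
      rw [norm_smul, norm_smul]
      calc _ ≤ ‖p - q‖ * (K * a) + a * (K * ‖p - q‖) := by gcongr
        _ = _ := by push_cast; ring
    · intro p _
      refine Continuous.continuousOn ?_
      have := hV.continuous
      fun_prop
    · intro τ hτ p hp
      rw [mem_closedBall_zero_iff] at hp
      have hp1 : ‖p.1‖ ≤ a := (norm_fst_le p).trans hp
      have hp2 : ‖p.2‖ ≤ a := (norm_snd_le p).trans hp
      rw [Prod.norm_def]
      refine max_le (by simp [f]; positivity) ?_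
      simp only [f]
      rw [norm_smul]
      calc _ ≤ a * (K * ‖p.2‖) := by gcongr; exact hbd τ hτ _ _ hp1
        _ ≤ a * (K * a) := by gcongr
        _ = _ := by push_cast; ring
    · simp only [sub_zero, sub_self]
      rw [max_eq_left zero_le_one]
      push_cast
      have : (0 : ℝ) < a := ha0
      nlinarith
  obtain ⟨α, hα, L, hL⟩ :=
    hPL.exists_forall_mem_closedBall_eq_hasDerivWithinAt_lipschitzOnWith
  have ha0' : (0 : ℝ) < a := ha0
  have hmem : ∀ θ : ℂ, ∀ z : E, ‖θ‖ ≤ (a : ℝ) / 2 → ‖z‖ ≤ (a : ℝ) / 2 →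
      ((θ, z) : ℂ × E) ∈ closedBall (0 : ℂ × E) ((a / 2 : ℝ≥0) : ℝ) := by
    intro θ z hθ hz
    rw [mem_closedBall_zero_iff, Prod.norm_def]
    push_cast
    exact max_le hθ hz
  -- the direction `θ` does not move along the flow
  have hconst : ∀ θ : ℂ, ∀ z : E, ‖θ‖ ≤ (a : ℝ) / 2 → ‖z‖ ≤ (a : ℝ) / 2 → ∀ τ ∈ Icc (0 : ℝ) 1,
      (α (θ, z) τ).1 = θ := by
    intro θ z hθ hz τ hτ
    obtain ⟨h0, hd⟩ := hα _ (hmem θ z hθ hz)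
    have h0' : α (θ, z) 0 = (θ, z) := h0
    have hd1 : ∀ σ ∈ Icc (0 : ℝ) 1,
        HasDerivWithinAt (fun σ => (α (θ, z) σ).1) 0 (Icc 0 1) σ := fun σ hσ =>
      (ContinuousLinearMap.fst ℝ ℂ E).hasFDerivAt.comp_hasDerivWithinAt σ (hd σ hσ)
    have := constant_of_has_deriv_right_zero (fun σ hσ => (hd1 σ hσ).continuousWithinAt)
      (fun σ hσ => (hd1 σ (Ico_subset_Icc_self hσ)).mono_of_mem_nhdsWithin
        (Icc_mem_nhdsGE_of_mem hσ)) τ hτ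
    rw [this, h0']
  refine ⟨fun θ z τ => (α (θ, z) τ).2, a / 2, L, by positivity, by linarith, ?_, ?_⟩
  · intro θ z hθ hz
    obtain ⟨h0, hd⟩ := hα _ (hmem θ z hθ hz)
    have h0' : α (θ, z) 0 = (θ, z) := h0
    refine ⟨by simp [h0'], fun τ hτ => ?_⟩
    have := (ContinuousLinearMap.snd ℝ ℂ E).hasFDerivAt.comp_hasDerivWithinAt τ (hd τ hτ)
    have h1 := hconst θ z hθ hz τ hτ
    simpa [f, h1] using! this
  · intro τ hτ θ z θ' z' hθ hz hθ' hz'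
    have := (hL τ hτ).norm_sub_le (hmem θ z hθ hz) (hmem θ' z' hθ' hz')
    exact (norm_snd_le (α (θ, z) τ - α (θ', z') τ)).trans this

/-- If `F` is constant along the integral curves of a Lipschitz vector field `V` that vanishes along
`ℂ × {0}`, then the time-one map of the field `θ • V (t₀ + τ θ, ·)` identifies
`F t₀` with `F (t₀ + θ)`, for every sufficiently small `θ`. -/
theorem isLipschitzTrivialOver_of_vectorField {n : ℕ}
    {F : ℂ → EuclideanSpace ℂ (Fin n) → ℂ}
    (H : ∀ t₀ : ℂ, ∃ (V : ℂ × EuclideanSpace ℂ (Fin n) → EuclideanSpace ℂ (Fin n)) (ρ : ℝ)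
      (K : ℝ≥0), 0 < ρ ∧ LipschitzOnWith K V (ball (t₀, 0) ρ) ∧
      (∀ t ∈ ball t₀ ρ, V (t, 0) = 0) ∧
      ∀ (θ : ℂ) (z : ℝ → EuclideanSpace ℂ (Fin n)), (∀ τ ∈ Icc (0 : ℝ) 1,
        (t₀ + τ * θ, z τ) ∈ ball (t₀, (0 : EuclideanSpace ℂ (Fin n))) ρ ∧
        HasDerivWithinAt z (θ • V (t₀ + τ * θ, z τ)) (Icc 0 1) τ) →
        F (t₀ + θ) (z 1) = F t₀ (z 0)) :
    IsLipschitzTrivialOver F univ := by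
  intro t₀ _
  obtain ⟨V₀, ρ, K₀, hρ, hLip, hV00, hF⟩ := H t₀
  obtain ⟨V, hV, hEq⟩ := hLip.extend_finite_dimension
  set K := lipschitzExtensionConstant (EuclideanSpace ℂ (Fin n)) * K₀
  have hmemρ : ∀ t ∈ ball t₀ ρ, ∀ z : EuclideanSpace ℂ (Fin n), ‖z‖ < ρ →
      (t, z) ∈ ball (t₀, (0 : EuclideanSpace ℂ (Fin n))) ρ := by
    intro t ht z hz
    rw [← ball_prod_same]
    exact ⟨ht, by simpa using hz⟩
  have hV0 : ∀ t ∈ ball t₀ ρ, V (t, 0) = 0 := fun t ht => by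
    rw [← hEq (hmemρ t ht 0 (by simpa using hρ)), hV00 t ht]
  obtain ⟨Φ, r, L, hr, hrρ, hΦ, hΦL⟩ := exists_radial_flow t₀ V hρ hV hV0
  obtain ⟨δ, hδ, hδr, hδK, hδρ, hδ1⟩ : ∃ δ : ℝ, 0 < δ ∧ δ ≤ r ∧ δ * (K * L) ≤ 1 / 2 ∧
      δ * Real.exp K < ρ ∧ δ ≤ 1 := by
    have hKL : (0 : ℝ) ≤ (K : ℝ) * L := by positivity
    refine ⟨min (min r (1 / (2 * ((K : ℝ) * L + 1)))) (min (ρ / (2 * Real.exp K)) 1),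
      by positivity, ?_, ?_, ?_, ?_⟩
    · exact (min_le_left _ _).trans (min_le_left _ _)
    · refine le_trans (mul_le_mul_of_nonneg_right
        ((min_le_left _ _).trans (min_le_right _ _)) hKL) ?_
      rw [one_div_mul_eq_div, div_le_iff₀ (by positivity)]
      linarith
    · refine lt_of_le_of_lt (mul_le_mul_of_nonneg_right
        ((min_le_right _ _).trans (min_le_left _ _)) (Real.exp_pos _).le) ?_
      have := Real.exp_pos (K : ℝ)
      rw [div_mul_eq_mul_div, div_lt_iff₀ (by positivity)]
      nlinarith
    · exact (min_le_right _ _).trans (min_le_right _ _)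
  have hball : ∀ τ ∈ Icc (0 : ℝ) 1, ∀ θ : ℂ, ‖θ‖ < δ → t₀ + τ * θ ∈ ball t₀ ρ := by
    intro τ hτ θ hθ
    rw [mem_ball, dist_eq_norm, add_sub_cancel_left, norm_mul, Complex.norm_real,
      Real.norm_of_nonneg hτ.1]
    nlinarith [hτ.2, norm_nonneg θ, hτ.1]
  -- Grönwall: trajectories stay in the ball where `V` agrees with the given field
  have hgron : ∀ θ z, ‖θ‖ < δ → ‖z‖ < δ → ∀ τ ∈ Icc (0 : ℝ) 1,
      ‖Φ θ z τ‖ ≤ ‖z‖ * Real.exp K := by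
    intro θ z hθ hz τ hτ
    obtain ⟨h0, hd⟩ := hΦ θ z (hθ.le.trans hδr) (hz.le.trans hδr)
    have := norm_le_gronwallBound_of_norm_deriv_right_le (δ := ‖z‖) (K := K) (ε := 0)
      (fun σ hσ => (hd σ hσ).continuousWithinAt)
      (fun σ hσ => (hd σ (Ico_subset_Icc_self hσ)).mono_of_mem_nhdsWithin
        (Icc_mem_nhdsGE_of_mem hσ)) (by rw [h0]) ?_ τ hτ
    · refine this.trans ?_
      rw [gronwallBound_ε0]
      gcongr
      rw [sub_zero]
      exact mul_le_of_le_one_right K.2 hτ.2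
    · intro σ hσ
      have h1 := hV.norm_sub_le (t₀ + σ * θ, Φ θ z σ) (t₀ + σ * θ, 0)
      rw [hV0 _ (hball σ (Ico_subset_Icc_self hσ) θ hθ), sub_zero] at h1
      have h2 : ‖V (t₀ + σ * θ, Φ θ z σ)‖ ≤ K * ‖Φ θ z σ‖ := by
        simpa [Prod.norm_def] using h1
      rw [norm_smul, add_zero]
      calc _ ≤ 1 * (K * ‖Φ θ z σ‖) := by gcongr; linarith
        _ = _ := one_mul _
  -- the time-one map is a small Lipschitz perturbation of the identity
  have happrox : ∀ θ, ‖θ‖ < δ → ApproximatesLinearOn (fun z => Φ θ z 1)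
      ((ContinuousLinearEquiv.refl ℂ (EuclideanSpace ℂ (Fin n)) :
        EuclideanSpace ℂ (Fin n) →L[ℂ] EuclideanSpace ℂ (Fin n))) (ball 0 δ) (1 / 2) := by
    intro θ hθ x hx y hy
    rw [mem_ball_zero_iff] at hx hy
    obtain ⟨hx0, hxd⟩ := hΦ θ x (hθ.le.trans hδr) (hx.le.trans hδr)
    obtain ⟨hy0, hyd⟩ := hΦ θ y (hθ.le.trans hδr) (hy.le.trans hδr)
    have := norm_image_sub_le_of_norm_deriv_le_segment'
      (C := δ * (K * L) * ‖x - y‖) (fun σ hσ => (hxd σ hσ).sub (hyd σ hσ)) ?_ 1 (by simp)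
    · simp only [Pi.sub_apply, hx0, hy0, sub_zero, mul_one] at this
      refine le_trans (by simpa using this) ?_
      push_cast
      gcongr
    · intro σ hσ
      have hσ' := Ico_subset_Icc_self hσ
      have h1 := hV.norm_sub_le (t₀ + σ * θ, Φ θ x σ) (t₀ + σ * θ, Φ θ y σ)
      have h2 := hΦL σ hσ' θ x θ y (hθ.le.trans hδr) (hx.le.trans hδr) (hθ.le.trans hδr)
        (hy.le.trans hδr)
      simp only [Prod.mk_sub_mk, sub_self, Prod.norm_mk, norm_zero, norm_nonneg,
        sup_of_le_right] at h1 h2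
      rw [← smul_sub, norm_smul]
      calc _ ≤ δ * (K * (L * ‖x - y‖)) := by
            gcongr
            exact h1.trans (by gcongr)
        _ = _ := by ring
  have hbi : ∀ θ, ‖θ‖ < δ → ∀ x ∈ ball (0 : EuclideanSpace ℂ (Fin n)) δ, ∀ y ∈ ball 0 δ,
      ‖(Φ θ x 1 - Φ θ y 1) - (x - y)‖ ≤ 1 / 2 * ‖x - y‖ := by
    intro θ hθ x hx y hy
    simpa using happrox θ hθ x hx y hy
  refine ⟨ball t₀ δ, isOpen_ball, mem_ball_self hδ, subset_univ _, ball 0 δ, isOpen_ball,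
    mem_ball_self hδ, fun t z => Φ (t - t₀) z 1, ?_, ?_⟩
  · have : LipschitzOnWith L (fun p : ℂ × EuclideanSpace ℂ (Fin n) => Φ (p.1 - t₀) p.2 1)
        (ball t₀ δ ×ˢ ball 0 δ) := by
      refine LipschitzOnWith.of_dist_le_mul fun p hp q hq => ?_
      have hp1 := mem_ball_iff_norm.1 hp.1
      have hq1 := mem_ball_iff_norm.1 hq.1
      have hp2 := mem_ball_zero_iff.1 hp.2
      have hq2 := mem_ball_zero_iff.1 hq.2
      have := hΦL 1 (by simp) (p.1 - t₀) p.2 (q.1 - t₀) q.2 (hp1.le.trans hδr)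
        (hp2.le.trans hδr) (hq1.le.trans hδr) (hq2.le.trans hδr)
      rw [dist_eq_norm, dist_eq_norm]
      simpa [Prod.norm_def] using this
    exact this.continuousOn
  · intro t ht
    have hθ : ‖t - t₀‖ < δ := mem_ball_iff_norm.1 ht
    refine ⟨?_, ⟨1 / 2, 3 / 2, by norm_num, by norm_num, fun x hx y hy => ?_⟩, ?_, fun x hx => ?_⟩
    · have := hgron (t - t₀) 0 hθ (by simpa using hδ) 1 (by simp)
      simpa using this
    · have h1 := hbi _ hθ x hx y hy
      have h2 := norm_sub_norm_le (x - y) (Φ (t - t₀) x 1 - Φ (t - t₀) y 1)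
      have h3 := norm_sub_norm_le (Φ (t - t₀) x 1 - Φ (t - t₀) y 1) (x - y)
      rw [norm_sub_rev (x - y)] at h2
      constructor <;> linarith
    · rcases subsingleton_or_nontrivial (EuclideanSpace ℂ (Fin n)) with hs | hs
      · exact isOpen_discrete _
      · refine (happrox _ hθ).open_image
          (ContinuousLinearEquiv.toNonlinearRightInverse _) isOpen_ball (Or.inr ?_)
        have : (ContinuousLinearEquiv.toNonlinearRightInverse
            (ContinuousLinearEquiv.refl ℂ (EuclideanSpace ℂ (Fin n)))).nnnorm = 1 := by
          simp [ContinuousLinearEquiv.toNonlinearRightInverse]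
        rw [this]
        norm_num
    · rw [mem_ball_zero_iff] at hx
      obtain ⟨h0, hd⟩ := hΦ (t - t₀) x (hθ.le.trans hδr) (hx.le.trans hδr)
      have hin : ∀ τ ∈ Icc (0 : ℝ) 1, (t₀ + τ * (t - t₀), Φ (t - t₀) x τ) ∈
          ball (t₀, (0 : EuclideanSpace ℂ (Fin n))) ρ := fun τ hτ =>
        hmemρ _ (hball τ hτ _ hθ) _ (lt_of_le_of_lt (hgron _ x hθ hx τ hτ)
          (lt_of_le_of_lt (by gcongr) hδρ))
      have := hF (t - t₀) (Φ (t - t₀) x) (fun τ hτ => ⟨hin τ hτ, by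
        rw [hEq (hin τ hτ)]; exact hd τ hτ⟩)
      simpa [h0] using this

/-! ### Functions controlled at a given scale -/

/-- Punctured neighbourhoods of the germ at the origin: `(t, x, y)` tends to `(t₀, 0, 0)` while
`(x, y) ≠ (0, 0)`. -/
noncomputable def puncturedNhds (t₀ : ℂ) : Filter (ℂ × ℂ × ℂ) := 𝓝[{p | p.2 ≠ 0}] (t₀, 0)

/-- The distance from `z.1` to `z.2`, measured in units of the scale `X` at `z.1`. -/
noncomputable def relDist (X : ℂ × ℂ × ℂ → ℝ) (z : (ℂ × ℂ × ℂ) × (ℂ × ℂ × ℂ)) : ℝ :=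
  ‖z.1 - z.2‖ / X z.1

/-- Pairs of points of a punctured neighbourhood whose distance is small compared with
the scale `X`. -/
noncomputable def closePairs (t₀ : ℂ) (X : ℂ × ℂ × ℂ → ℝ) :
    Filter ((ℂ × ℂ × ℂ) × (ℂ × ℂ × ℂ)) :=
  (puncturedNhds t₀ ×ˢ puncturedNhds t₀) ⊓ comap (relDist X) (𝓝 0)

/-- A function of `(t, x, y)` that vanishes exactly along `x = y = 0`, is at most `‖(x, y)‖`, and is
Lipschitz for `‖(x, y)‖ ≤ 1`. It serves as the distance below which controlled
functions vary slowly. -/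
structure IsScale (X : ℂ × ℂ × ℂ → ℝ) : Prop where
  pos : ∀ p, p.2 ≠ 0 → 0 < X p
  eq_zero : ∀ p, p.2 = 0 → X p = 0
  le_norm : ∀ p, ‖p.2‖ ≤ 1 → X p ≤ ‖p.2‖
  lipschitz : ∃ L : ℝ, 0 < L ∧ ∀ p q, ‖p.2‖ ≤ 1 → ‖q.2‖ ≤ 1 → |X p - X q| ≤ L * ‖p - q‖

/-- `g` has size `O(M)` and its local Lipschitz constant at scale `X` is `O(M / X)`. -/
def Controlled (t₀ : ℂ) (X M : ℂ × ℂ × ℂ → ℝ) (g : ℂ × ℂ × ℂ → ℂ) : Prop :=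
  g =O[puncturedNhds t₀] M ∧
    (fun z : (ℂ × ℂ × ℂ) × (ℂ × ℂ × ℂ) => g z.1 - g z.2) =O[closePairs t₀ X]
      fun z => M z.1 * relDist X z

variable {t₀ : ℂ} {X M M₁ M₂ : ℂ × ℂ × ℂ → ℝ} {g g₁ g₂ : ℂ × ℂ × ℂ → ℂ}

theorem tendsto_fst_closePairs : Tendsto Prod.fst (closePairs t₀ X) (puncturedNhds t₀) :=
  tendsto_fst.mono_left inf_le_left

theorem tendsto_snd_closePairs : Tendsto Prod.snd (closePairs t₀ X) (puncturedNhds t₀) :=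
  tendsto_snd.mono_left inf_le_left

theorem tendsto_relDist_closePairs : Tendsto (relDist X) (closePairs t₀ X) (𝓝 0) :=
  tendsto_comap.mono_left inf_le_right

theorem eventually_puncturedNhds_iff {P : ℂ × ℂ × ℂ → Prop} :
    (∀ᶠ p in puncturedNhds t₀, P p) ↔
      ∃ ρ > 0, ∀ p : ℂ × ℂ × ℂ, ‖p.1 - t₀‖ < ρ → ‖p.2‖ < ρ → p.2 ≠ 0 → P p := by
  rw [puncturedNhds, eventually_nhdsWithin_iff, Metric.eventually_nhds_iff_ball]
  refine exists_congr fun ρ => and_congr_right fun _ => ⟨fun h p h1 h2 => h p ?_,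
    fun h p hp => ?_⟩
  · rw [← ball_prod_same]
    exact ⟨by simpa [dist_eq_norm] using h1, by simpa using h2⟩
  · rw [← ball_prod_same] at hp
    exact h p (by simpa [dist_eq_norm] using hp.1) (by simpa using hp.2)

theorem eventually_ne_zero_puncturedNhds : ∀ᶠ p in puncturedNhds t₀, p.2 ≠ 0 :=
  eventually_puncturedNhds_iff.2 ⟨1, one_pos, fun _ _ _ h => h⟩

theorem eventually_norm_lt_puncturedNhds {r : ℝ} (hr : 0 < r) :
    ∀ᶠ p in puncturedNhds t₀, ‖p.2‖ < r :=
  eventually_puncturedNhds_iff.2 ⟨r, hr, fun _ _ h _ => h⟩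

theorem tendsto_fst_puncturedNhds : Tendsto Prod.fst (puncturedNhds t₀) (𝓝 t₀) :=
  (continuous_fst.tendsto' (t₀, (0 : ℂ × ℂ)) t₀ rfl).mono_left nhdsWithin_le_nhds

namespace Controlled

theorem isBigO_fst (h : Controlled t₀ X M g) :
    (fun z : (ℂ × ℂ × ℂ) × (ℂ × ℂ × ℂ) => g z.1) =O[closePairs t₀ X] fun z => M z.1 :=
  h.1.comp_tendsto tendsto_fst_closePairs

theorem isLittleO_sub (h : Controlled t₀ X M g) :
    (fun z : (ℂ × ℂ × ℂ) × (ℂ × ℂ × ℂ) => g z.1 - g z.2) =o[closePairs t₀ X] fun z => M z.1 := by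
  refine h.2.trans_isLittleO ?_
  have : relDist X =o[closePairs t₀ X] fun _ => (1 : ℝ) :=
    (isLittleO_one_iff ℝ).2 tendsto_relDist_closePairs
  simpa using (isBigO_refl (fun z : (ℂ × ℂ × ℂ) × (ℂ × ℂ × ℂ) => M z.1) _).mul_isLittleO this

theorem isBigO_snd (h : Controlled t₀ X M g) :
    (fun z : (ℂ × ℂ × ℂ) × (ℂ × ℂ × ℂ) => g z.2) =O[closePairs t₀ X] fun z => M z.1 := by
  simpa using h.isBigO_fst.sub h.isLittleO_sub.isBigO

theorem const (c : ℂ) : Controlled t₀ X (fun _ => 1) fun _ => c :=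
  ⟨isBigO_const_const _ one_ne_zero _, by simpa using isBigO_zero _ _⟩

theorem add (h₁ : Controlled t₀ X M g₁) (h₂ : Controlled t₀ X M g₂) :
    Controlled t₀ X M fun p => g₁ p + g₂ p :=
  ⟨h₁.1.add h₂.1, (h₁.2.add h₂.2).congr_left fun z => by ring⟩

theorem neg (h : Controlled t₀ X M g) : Controlled t₀ X M fun p => -g p :=
  ⟨h.1.neg_left, h.2.neg_left.congr_left fun z => by ring⟩

theorem mul (h₁ : Controlled t₀ X M₁ g₁) (h₂ : Controlled t₀ X M₂ g₂) :
    Controlled t₀ X (fun p => M₁ p * M₂ p) fun p => g₁ p * g₂ p := by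
  refine ⟨h₁.1.mul h₂.1, ?_⟩
  have := ((h₁.isBigO_fst.mul h₂.2).congr_right (g₂ := fun z => M₁ z.1 * M₂ z.1 * relDist X z)
    fun z => by ring).add ((h₁.2.mul h₂.isBigO_snd).congr_right
      (g₂ := fun z => M₁ z.1 * M₂ z.1 * relDist X z) fun z => by ring)
  exact this.congr_left fun z => by ring

theorem const_mul (c : ℂ) (h : Controlled t₀ X M g) : Controlled t₀ X M fun p => c * g p := by
  simpa using (const c).mul h

theorem pow (h : Controlled t₀ X M g) (k : ℕ) :
    Controlled t₀ X (fun p => M p ^ k) fun p => g p ^ k := by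
  induction k with
  | zero => simpa using const 1
  | succ k ih => simpa only [pow_succ] using ih.mul h

theorem star (h : Controlled t₀ X M g) : Controlled t₀ X M fun p => conj (g p) :=
  ⟨IsBigO.of_norm_left (by simpa using h.1.norm_left), IsBigO.of_norm_left (by
    simpa only [← map_sub, RCLike.norm_conj] using h.2.norm_left)⟩

theorem mono (h : Controlled t₀ X M₁ g) (hM : M₁ =O[puncturedNhds t₀] M₂) :
    Controlled t₀ X M₂ g :=
  ⟨h.1.trans hM, h.2.trans ((hM.comp_tendsto tendsto_fst_closePairs).mul (isBigO_refl _ _))⟩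

/-- A controlled function that is also bounded below by its control has a controlled inverse. -/
theorem inv (h : Controlled t₀ X M g) (hM : M =O[puncturedNhds t₀] g)
    (hg : ∀ᶠ p in puncturedNhds t₀, g p ≠ 0) :
    Controlled t₀ X (fun p => (M p)⁻¹) fun p => (g p)⁻¹ := by
  have hM0 : ∀ᶠ p in puncturedNhds t₀, M p ≠ 0 := by
    filter_upwards [h.1.eq_zero_imp, hg] with p h1 h2 h3 using h2 (h1 h3)
  have h1 : (fun z : (ℂ × ℂ × ℂ) × (ℂ × ℂ × ℂ) => (g z.1)⁻¹) =O[closePairs t₀ X]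
      fun z => (M z.1)⁻¹ :=
    (hM.comp_tendsto tendsto_fst_closePairs).inv_rev
      ((tendsto_fst_closePairs.eventually hM0).mono fun p hp h => absurd h hp)
  have h2 : (fun z : (ℂ × ℂ × ℂ) × (ℂ × ℂ × ℂ) => (g z.2)⁻¹) =O[closePairs t₀ X]
      fun z => (M z.1)⁻¹ := by
    refine IsBigO.inv_rev ?_
      ((tendsto_fst_closePairs.eventually hM0).mono fun p hp h => absurd h hp)
    have h3 := hM.comp_tendsto (tendsto_fst_closePairs (t₀ := t₀) (X := X))
    have h4 := (h.isLittleO_sub.trans_isBigO h3).right_isBigO_sub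
    refine h3.trans (h4.congr_right fun z => ?_)
    simp
  refine ⟨hM.inv_rev (hM0.mono fun p hp h => absurd h hp), ?_⟩
  refine ((h1.mul h2).mul h.2.neg_left).congr' ?_ ?_
  · filter_upwards [tendsto_fst_closePairs.eventually hg, tendsto_snd_closePairs.eventually hg]
      with z hz1 hz2
    field_simp
    ring
  · filter_upwards [tendsto_fst_closePairs.eventually hM0] with z hz
    field_simp

theorem congr (h : Controlled t₀ X M g₁) (hg : ∀ p, g₁ p = g₂ p) : Controlled t₀ X M g₂ := by
  rwa [← funext hg]

/-- A Lipschitz function of size `O(M)` is controlled by `M` as soon as `M` dominates the scale. -/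
theorem of_lipschitz (hX : IsScale X) {L : ℝ}
    (hL : ∀ p q, ‖p.2‖ ≤ 1 → ‖q.2‖ ≤ 1 → ‖g p - g q‖ ≤ L * ‖p - q‖)
    (hg : g =O[puncturedNhds t₀] M) (hXM : X =O[puncturedNhds t₀] M) :
    Controlled t₀ X M g := by
  refine ⟨hg, ?_⟩
  have h1 : (fun z : (ℂ × ℂ × ℂ) × (ℂ × ℂ × ℂ) => g z.1 - g z.2) =O[closePairs t₀ X]
      fun z => X z.1 * relDist X z := by
    refine IsBigO.of_bound L ?_
    filter_upwards [tendsto_fst_closePairs.eventually eventually_ne_zero_puncturedNhds,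
      tendsto_fst_closePairs.eventually (eventually_norm_lt_puncturedNhds one_pos),
      tendsto_snd_closePairs.eventually (eventually_norm_lt_puncturedNhds one_pos)] with z h0 h1 h2
    have := hX.pos _ h0
    rw [relDist, mul_div_cancel₀ _ this.ne', norm_norm]
    exact hL _ _ h1.le h2.le
  exact h1.trans ((hXM.comp_tendsto tendsto_fst_closePairs).mul (isBigO_refl _ _))

/-- A function controlled by the scale itself, extended by zero, is Lipschitz: for points that are
far apart compared with the scale, the size estimate is enough. -/
theorem exists_lipschitzOnWith (hX : IsScale X) (h : Controlled t₀ X X g) :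
    ∃ (ρ : ℝ) (K : ℝ≥0), 0 < ρ ∧
      LipschitzOnWith K ({p : ℂ × ℂ × ℂ | p.2 ≠ 0}.indicator g) (ball (t₀, 0) ρ) := by
  obtain ⟨C₁, hC₁, h₁⟩ := h.1.exists_pos
  obtain ⟨C₂, hC₂, h₂⟩ := h.2.exists_pos
  obtain ⟨L, hL, hXL⟩ := hX.lipschitz
  obtain ⟨ρ₁, hρ₁, h₁⟩ := eventually_puncturedNhds_iff.1 h₁.bound
  obtain ⟨δ, hδ, ρ₂, hρ₂, h₂⟩ : ∃ δ > 0, ∃ ρ > 0, ∀ p q : ℂ × ℂ × ℂ, ‖p.1 - t₀‖ < ρ →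
      ‖p.2‖ < ρ → p.2 ≠ 0 → ‖q.1 - t₀‖ < ρ → ‖q.2‖ < ρ → q.2 ≠ 0 → relDist X (p, q) < δ →
      ‖g p - g q‖ ≤ C₂ * ‖p - q‖ := by
    have := h₂.bound
    rw [closePairs, Filter.eventually_inf] at this
    obtain ⟨s, hs, u, hu, hsu⟩ := this
    obtain ⟨δ, hδ, hδu⟩ := ((nhds_basis_ball (x := (0 : ℝ))).comap (relDist X)).mem_iff.1 hu
    obtain ⟨v, hv, w, hw, hvw⟩ := Filter.mem_prod_iff.1 hs
    obtain ⟨a, ha, hav⟩ := eventually_puncturedNhds_iff.1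
      (show ∀ᶠ p in puncturedNhds t₀, p ∈ v from hv)
    obtain ⟨b, hb, hbw⟩ := eventually_puncturedNhds_iff.1
      (show ∀ᶠ p in puncturedNhds t₀, p ∈ w from hw)
    refine ⟨δ, hδ, min a b, lt_min ha hb, fun p q h1 h2 h3 h4 h5 h6 h7 => ?_⟩
    have hp := hX.pos p h3
    have hu' : ((p, q) : (ℂ × ℂ × ℂ) × (ℂ × ℂ × ℂ)) ∈ u := hδu (by
      rw [mem_preimage, mem_ball_zero_iff, Real.norm_of_nonneg
        (show 0 ≤ relDist X (p, q) from div_nonneg (norm_nonneg _) hp.le)]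
      exact h7)
    have hs' : ((p, q) : (ℂ × ℂ × ℂ) × (ℂ × ℂ × ℂ)) ∈ s := hvw
      ⟨hav p (h1.trans_le (min_le_left _ _)) (h2.trans_le (min_le_left _ _)) h3,
        hbw q (h4.trans_le (min_le_right _ _)) (h5.trans_le (min_le_right _ _)) h6⟩
    have := hsu _ ⟨hs', hu'⟩
    simp only [relDist] at this
    rwa [mul_div_cancel₀ _ hp.ne', norm_norm] at this
  have hK : 0 ≤ C₂ + C₁ * L + 2 * C₁ / δ := by positivity
  refine ⟨min (min ρ₁ ρ₂) 1, .mk _ hK, by positivity,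
    LipschitzOnWith.of_dist_le_mul fun p hp q hq => ?_⟩
  rw [← ball_prod_same] at hp hq
  have hp1 : ‖p.1 - t₀‖ < min (min ρ₁ ρ₂) 1 := by simpa [dist_eq_norm] using hp.1
  have hp2 : ‖p.2‖ < min (min ρ₁ ρ₂) 1 := by simpa using hp.2
  have hq1 : ‖q.1 - t₀‖ < min (min ρ₁ ρ₂) 1 := by simpa [dist_eq_norm] using hq.1
  have hq2 : ‖q.2‖ < min (min ρ₁ ρ₂) 1 := by simpa using hq.2
  simp only [lt_min_iff] at hp1 hp2 hq1 hq2
  have hX0 : ∀ p, 0 ≤ X p := fun p => by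
    by_cases h : p.2 = 0
    · exact (hX.eq_zero p h).ge
    · exact (hX.pos p h).le
  have hbound : ∀ p : ℂ × ℂ × ℂ, ‖p.1 - t₀‖ < ρ₁ → ‖p.2‖ < ρ₁ →
      ‖({p : ℂ × ℂ × ℂ | p.2 ≠ 0}.indicator g) p‖ ≤ C₁ * X p := by
    intro p h1 h2
    by_cases h : p.2 = 0
    · rw [indicator_of_notMem (by simpa using h), norm_zero]
      exact mul_nonneg hC₁.le (hX0 p)
    · rw [indicator_of_mem (by simpa using h)]
      simpa [abs_of_nonneg (hX0 p)] using h₁ p h1 h2 h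
  have hpb := hbound p hp1.1.1 hp2.1.1
  have hqb := hbound q hq1.1.1 hq2.1.1
  have hpq := hXL p q hp2.2.le hq2.2.le
  rw [dist_eq_norm, dist_eq_norm, NNReal.coe_mk]
  have hn : 0 ≤ ‖p - q‖ := norm_nonneg _
  by_cases hfar : δ * X p ≤ ‖p - q‖
  · have hq' : X q ≤ X p + L * ‖p - q‖ := by linarith [neg_abs_le (X p - X q)]
    have hp' : X p ≤ ‖p - q‖ / δ := by rw [le_div_iff₀ hδ]; linarith
    calc _ ≤ C₁ * X p + C₁ * X q := (norm_sub_le _ _).trans (add_le_add hpb hqb)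
      _ ≤ C₁ * (‖p - q‖ / δ) + C₁ * (‖p - q‖ / δ + L * ‖p - q‖) := by
        gcongr
        linarith
      _ = (C₁ * L + 2 * C₁ / δ) * ‖p - q‖ := by ring
      _ ≤ _ := by gcongr; linarith
  · push Not at hfar
    have hp0 : p.2 ≠ 0 := by
      intro h
      rw [hX.eq_zero p h] at hfar
      linarith
    by_cases hq0 : q.2 = 0
    · rw [hX.eq_zero q hq0, sub_zero, abs_of_nonneg (hX0 p)] at hpq
      rw [hX.eq_zero q hq0, mul_zero] at hqb
      calc _ ≤ C₁ * X p + 0 := (norm_sub_le _ _).trans (add_le_add hpb hqb)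
        _ ≤ C₁ * (L * ‖p - q‖) + 0 := by gcongr
        _ = (C₁ * L) * ‖p - q‖ := by ring
        _ ≤ _ := by
          gcongr
          have : 0 < 2 * C₁ / δ := by positivity
          linarith
    · rw [indicator_of_mem (by simpa using hp0), indicator_of_mem (by simpa using hq0)]
      refine (h₂ p q hp1.1.2 hp2.1.2 hp0 hq1.1.2 hq2.1.2 hq0 ?_).trans ?_
      · rw [relDist, div_lt_iff₀ (hX.pos p hp0)]
        exact hfar
      · gcongr
        have : 0 < 2 * C₁ / δ := by positivity
        have : 0 < C₁ * L := by positivity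
        linarith

end Controlled

/-! ### Solving the infinitesimal equation with a frame of two vector fields -/

/-- `ft`, `fx`, `fy` are the partial derivatives of `f`, in the form of the chain rule along real
curves. -/
def HasPartials (f : ℂ → ℂ → ℂ → ℂ) (ft fx fy : ℂ × ℂ × ℂ → ℂ) : Prop :=
  ∀ (T X Y : ℝ → ℂ) (T' X' Y' : ℂ) (s : Set ℝ) (τ : ℝ), HasDerivWithinAt T T' s τ →
    HasDerivWithinAt X X' s τ → HasDerivWithinAt Y Y' s τ →
    HasDerivWithinAt (fun τ => f (T τ) (X τ) (Y τ))
      (ft (T τ, X τ, Y τ) * T' + fx (T τ, X τ, Y τ) * X' + fy (T τ, X τ, Y τ) * Y') s τ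

/-- Thom–Levine criterion: the family is Lipschitz trivial if `∂f/∂t + A ∂f/∂x + B ∂f/∂y = 0` has
Lipschitz solutions `A`, `B` vanishing at the origin. -/
theorem isLipschitzTrivial_of_solution {f : ℂ → ℂ → ℂ → ℂ} {ft fx fy : ℂ × ℂ × ℂ → ℂ}
    (hf : HasPartials f ft fx fy)
    (H : ∀ t₀ : ℂ, ∃ (A B : ℂ × ℂ × ℂ → ℂ) (ρ : ℝ) (K : ℝ≥0), 0 < ρ ∧
      LipschitzOnWith K A (ball (t₀, 0) ρ) ∧ LipschitzOnWith K B (ball (t₀, 0) ρ) ∧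
      (∀ t, A (t, 0) = 0 ∧ B (t, 0) = 0) ∧
      ∀ p ∈ ball (t₀, (0 : ℂ × ℂ)) ρ, ft p + A p * fx p + B p * fy p = 0) :
    IsLipschitzTrivial f := by
  refine isLipschitzTrivialOver_of_vectorField fun t₀ => ?_
  obtain ⟨A, B, ρ, K, hρ, hA, hB, h0, hsol⟩ := H t₀
  let π : ℂ × EuclideanSpace ℂ (Fin 2) → ℂ × ℂ × ℂ := fun p => (p.1, p.2 0, p.2 1)
  have hcoord : ∀ (z : EuclideanSpace ℂ (Fin 2)) i, ‖z i‖ ≤ ‖z‖ := fun z i =>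
    PiLp.norm_apply_le z i
  have hπ : ∀ p ∈ ball (t₀, (0 : EuclideanSpace ℂ (Fin 2))) ρ, π p ∈ ball (t₀, (0 : ℂ × ℂ)) ρ := by
    intro p hp
    rw [← ball_prod_same] at hp ⊢
    refine ⟨hp.1, ?_⟩
    have := mem_ball_zero_iff.1 hp.2
    rw [mem_ball_zero_iff, Prod.norm_def]
    exact max_lt ((hcoord p.2 0).trans_lt this) ((hcoord p.2 1).trans_lt this)
  have hπL : ∀ p q, ‖π p - π q‖ ≤ ‖p - q‖ := by
    intro p q
    rw [Prod.norm_def, Prod.norm_def, Prod.norm_def]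
    refine max_le (le_max_left _ _) (le_max_of_le_right (max_le ?_ ?_))
    · exact hcoord (p.2 - q.2) 0
    · exact hcoord (p.2 - q.2) 1
  refine ⟨fun p => !₂[A (π p), B (π p)], ρ, 2 * K, hρ, ?_, ?_, ?_⟩
  · refine LipschitzOnWith.of_dist_le_mul fun p hp q hq => ?_
    have h1 := (hA.norm_sub_le (hπ p hp) (hπ q hq)).trans
      (mul_le_mul_of_nonneg_left (hπL p q) K.2)
    have h2 := (hB.norm_sub_le (hπ p hp) (hπ q hq)).trans
      (mul_le_mul_of_nonneg_left (hπL p q) K.2)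
    rw [dist_eq_norm, dist_eq_norm, EuclideanSpace.norm_eq, Real.sqrt_le_iff]
    refine ⟨by positivity, ?_⟩
    rw [Fin.sum_univ_two]
    change ‖A (π p) - A (π q)‖ ^ 2 + ‖B (π p) - B (π q)‖ ^ 2 ≤ _
    have h3 := norm_nonneg (A (π p) - A (π q))
    have h4 := norm_nonneg (B (π p) - B (π q))
    have h5 : (0 : ℝ) ≤ K * ‖p - q‖ := by positivity
    push_cast
    have e1 := pow_le_pow_left₀ h3 h1 2
    have e2 := pow_le_pow_left₀ h4 h2 2
    have : (2 * (K : ℝ) * ‖p - q‖) ^ 2 = 4 * (K * ‖p - q‖) ^ 2 := by ring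
    rw [this]
    nlinarith [sq_nonneg ((K : ℝ) * ‖p - q‖)]
  · intro t _
    have : π (t, 0) = (t, 0) := rfl
    beta_reduce
    rw [this, (h0 t).1, (h0 t).2]
    ext i
    fin_cases i <;> rfl
  · intro θ z hz
    have hd : ∀ τ ∈ Icc (0 : ℝ) 1, HasDerivWithinAt
        (fun τ : ℝ => f (t₀ + τ * θ) (z τ 0) (z τ 1)) 0 (Icc 0 1) τ := by
      intro τ hτ
      obtain ⟨hm, hz'⟩ := hz τ hτ
      have hT : HasDerivWithinAt (fun τ : ℝ => t₀ + (τ : ℂ) * θ) θ (Icc 0 1) τ := by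
        have : HasDerivAt (fun τ : ℝ => (τ : ℂ)) 1 τ := Complex.ofRealCLM.hasDerivAt
        simpa using ((this.mul_const θ).const_add t₀).hasDerivWithinAt
      have hc : ∀ i, HasDerivWithinAt (fun τ => z τ i)
          ((θ • !₂[A (π (t₀ + τ * θ, z τ)), B (π (t₀ + τ * θ, z τ))] :
            EuclideanSpace ℂ (Fin 2)) i) (Icc 0 1) τ := fun i =>
        ((PiLp.proj 2 (𝕜 := ℝ) (fun _ : Fin 2 => ℂ) i).hasFDerivAt).comp_hasDerivWithinAt τ hz'
      have h1 := hf _ _ _ _ _ _ _ τ hT (hc 0) (hc 1)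
      refine h1.congr_deriv ?_
      have h2 := hsol _ (hπ _ hm)
      simp only [π] at h2 ⊢
      simp only [PiLp.smul_apply, Matrix.cons_val_zero, Matrix.cons_val_one,
        Matrix.cons_val_fin_one, smul_eq_mul]
      linear_combination θ * h2
    have := constant_of_has_deriv_right_zero (fun σ hσ => (hd σ hσ).continuousWithinAt)
      (fun σ hσ => (hd σ (Ico_subset_Icc_self hσ)).mono_of_mem_nhdsWithin
        (Icc_mem_nhdsGE_of_mem hσ)) 1 (by simp)
    simpa using this

/-- Suppose `f` has derivatives `G₁`, `G₂` of size at most `M` along two vector fields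
`(a₁, b₁)`, `(a₂, b₂)`, and that they are never both small compared with `M`. After correction by a
smooth field `(A₀, B₀)`, the equation `∂f/∂t + A ∂f/∂x + B ∂f/∂y = 0` is solved by
`(A₀, B₀) - R (conj G₁ (a₁, b₁) + conj G₂ (a₂, b₂)) / (|G₁|² + |G₂|²)`, where
`R = ∂f/∂t + A₀ ∂f/∂x + B₀ ∂f/∂y`; this field is Lipschitz when the `R aᵢ`, `R bᵢ` are
controlled by `M X`. -/
theorem isLipschitzTrivial_of_frame {f : ℂ → ℂ → ℂ → ℂ} {ft fx fy : ℂ × ℂ × ℂ → ℂ}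
    (hf : HasPartials f ft fx fy) (hft : ∀ t, ft (t, 0) = 0) {X M : ℂ × ℂ × ℂ → ℝ}
    (hX : IsScale X) {A₀ B₀ a₁ b₁ a₂ b₂ : ℂ × ℂ × ℂ → ℂ}
    (hA₀ : ContDiff ℂ 1 A₀) (hB₀ : ContDiff ℂ 1 B₀) (hA₀0 : ∀ t, A₀ (t, 0) = 0)
    (hB₀0 : ∀ t, B₀ (t, 0) = 0) (hM : ∀ p, p.2 ≠ 0 → 0 < M p)
    (H : ∀ t₀ : ℂ,
      Controlled t₀ X M (fun p => a₁ p * fx p + b₁ p * fy p) ∧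
      Controlled t₀ X M (fun p => a₂ p * fx p + b₂ p * fy p) ∧
      (∃ c > 0, ∀ᶠ p in puncturedNhds t₀,
        c * M p ≤ ‖a₁ p * fx p + b₁ p * fy p‖ + ‖a₂ p * fx p + b₂ p * fy p‖) ∧
      Controlled t₀ X (fun p => M p * X p) (fun p => (ft p + A₀ p * fx p + B₀ p * fy p) * a₁ p) ∧
      Controlled t₀ X (fun p => M p * X p) (fun p => (ft p + A₀ p * fx p + B₀ p * fy p) * b₁ p) ∧
      Controlled t₀ X (fun p => M p * X p) (fun p => (ft p + A₀ p * fx p + B₀ p * fy p) * a₂ p) ∧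
      Controlled t₀ X (fun p => M p * X p) (fun p => (ft p + A₀ p * fx p + B₀ p * fy p) * b₂ p)) :
    IsLipschitzTrivial f := by
  refine isLipschitzTrivial_of_solution hf fun t₀ => ?_
  obtain ⟨hG₁, hG₂, ⟨c, hc, hlow⟩, ha₁, hb₁, ha₂, hb₂⟩ := H t₀
  set G₁ : ℂ × ℂ × ℂ → ℂ := fun p => a₁ p * fx p + b₁ p * fy p with hG₁d
  set G₂ : ℂ × ℂ × ℂ → ℂ := fun p => a₂ p * fx p + b₂ p * fy p with hG₂d
  set R : ℂ × ℂ × ℂ → ℂ := fun p => ft p + A₀ p * fx p + B₀ p * fy p with hRd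
  let D : ℂ × ℂ × ℂ → ℂ := fun p => G₁ p * conj (G₁ p) + G₂ p * conj (G₂ p)
  have hDnorm : ∀ p, ‖D p‖ = ‖G₁ p‖ ^ 2 + ‖G₂ p‖ ^ 2 := by
    intro p
    simp only [D, Complex.mul_conj, ← Complex.ofReal_add, Complex.norm_real,
      Complex.normSq_eq_norm_sq]
    exact Real.norm_of_nonneg (by positivity)
  have hDlow : ∀ᶠ p in puncturedNhds t₀, c ^ 2 / 2 * (M p * M p) ≤ ‖D p‖ := by
    filter_upwards [hlow, eventually_ne_zero_puncturedNhds] with p hp hp0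
    rw [hDnorm]
    have h1 := hM p hp0
    have h2 := pow_le_pow_left₀ (by positivity) hp 2
    nlinarith [sq_nonneg (‖G₁ p‖ - ‖G₂ p‖)]
  have hD0 : ∀ᶠ p in puncturedNhds t₀, D p ≠ 0 := by
    filter_upwards [hDlow, eventually_ne_zero_puncturedNhds] with p hp hp0 h
    have h1 := hM p hp0
    rw [h, norm_zero] at hp
    have : 0 < c ^ 2 / 2 * (M p * M p) := by positivity
    linarith
  have hDinv : Controlled t₀ X (fun p => (M p * M p)⁻¹) fun p => (D p)⁻¹ := by
    refine ((hG₁.mul hG₁.star).add (hG₂.mul hG₂.star)).inv ?_ hD0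
    refine IsBigO.of_bound (2 / c ^ 2) ?_
    filter_upwards [hDlow] with p hp
    rw [Real.norm_of_nonneg (mul_self_nonneg _), div_mul_eq_mul_div, le_div_iff₀ (by positivity)]
    change _ ≤ 2 * ‖D p‖
    linarith
  have key : ∀ {u v : ℂ × ℂ × ℂ → ℂ}, Controlled t₀ X (fun p => M p * X p) (fun p => R p * u p) →
      Controlled t₀ X (fun p => M p * X p) (fun p => R p * v p) →
      Controlled t₀ X X fun p =>
        -((R p * u p * conj (G₁ p) + R p * v p * conj (G₂ p)) * (D p)⁻¹) := by
    intro u v hu hv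
    refine ((((hu.mul hG₁.star).add (hv.mul hG₂.star)).mul hDinv).neg).mono
      (EventuallyEq.isBigO ?_)
    filter_upwards [eventually_ne_zero_puncturedNhds] with p hp
    have := (hM p hp).ne'
    field_simp
  obtain ⟨ρ₁, K₁, hρ₁, hL₁⟩ := (key ha₁ ha₂).exists_lipschitzOnWith hX
  obtain ⟨ρ₂, K₂, hρ₂, hL₂⟩ := (key hb₁ hb₂).exists_lipschitzOnWith hX
  obtain ⟨K₃, s₃, hs₃, hL₃⟩ := (hA₀.contDiffAt (x := (t₀, 0))).exists_lipschitzOnWith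
  obtain ⟨K₄, s₄, hs₄, hL₄⟩ := (hB₀.contDiffAt (x := (t₀, 0))).exists_lipschitzOnWith
  obtain ⟨ρ₃, hρ₃, hs₃⟩ := Metric.mem_nhds_iff.1 hs₃
  obtain ⟨ρ₄, hρ₄, hs₄⟩ := Metric.mem_nhds_iff.1 hs₄
  obtain ⟨ρ₅, hρ₅, hD0⟩ := eventually_puncturedNhds_iff.1 hD0
  set ρ := min (min (min ρ₁ ρ₂) (min ρ₃ ρ₄)) ρ₅
  have h1 : ρ ≤ ρ₁ := (min_le_left _ _).trans ((min_le_left _ _).trans (min_le_left _ _))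
  have h2 : ρ ≤ ρ₂ := (min_le_left _ _).trans ((min_le_left _ _).trans (min_le_right _ _))
  have h3 : ρ ≤ ρ₃ := (min_le_left _ _).trans ((min_le_right _ _).trans (min_le_left _ _))
  have h4 : ρ ≤ ρ₄ := (min_le_left _ _).trans ((min_le_right _ _).trans (min_le_right _ _))
  have h5 : ρ ≤ ρ₅ := min_le_right _ _
  refine ⟨_, _, ρ, max (K₃ + K₁) (K₄ + K₂), by positivity,
    ((((hL₃.mono hs₃).mono (ball_subset_ball h3)).add
      (hL₁.mono (ball_subset_ball h1))).weaken (le_max_left _ _)),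
    ((((hL₄.mono hs₄).mono (ball_subset_ball h4)).add
      (hL₂.mono (ball_subset_ball h2))).weaken (le_max_right _ _)), ?_, ?_⟩
  · intro t
    simp [hA₀0, hB₀0]
  · intro p hp
    by_cases hp0 : p.2 = 0
    · have : p = (p.1, 0) := by rw [← hp0]
      rw [this]
      simp [hA₀0, hB₀0, hft]
    · rw [← ball_prod_same] at hp
      have hDp := hD0 p (by simpa [dist_eq_norm] using (ball_subset_ball h5) hp.1)
        (by simpa using (ball_subset_ball h5) hp.2) hp0
      rw [indicator_of_mem (by simpa using hp0), indicator_of_mem (by simpa using hp0)]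
      have hDe : D p = G₁ p * conj (G₁ p) + G₂ p * conj (G₂ p) := rfl
      have hRe : R p = ft p + A₀ p * fx p + B₀ p * fy p := rfl
      have hG₁e : G₁ p = a₁ p * fx p + b₁ p * fy p := rfl
      have hG₂e : G₂ p = a₂ p * fx p + b₂ p * fy p := rfl
      field_simp
      linear_combination D p * (-hRe) + R p * hDe +
        R p * conj (G₁ p) * hG₁e + R p * conj (G₂ p) * hG₂e

/-! ### The weight function -/

/-- The gauge `max (|x|^(1/m)) (|y|^(1/n))`: homogeneous of degree one when `x`, `y` have weights
`m`, `n`. This is unrelated to the Minkowski gauge of a convex set. -/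
noncomputable def gauge (m n : ℕ) (p : ℂ × ℂ × ℂ) : ℝ :=
  max (‖p.2.1‖ ^ (m : ℝ)⁻¹) (‖p.2.2‖ ^ (n : ℝ)⁻¹)

section gauge

variable {m n : ℕ} {t₀ : ℂ}

theorem gauge_nonneg (p : ℂ × ℂ × ℂ) : 0 ≤ gauge m n p :=
  le_max_of_le_left (by positivity)

theorem norm_fst_le_gauge (hm : 0 < m) (p : ℂ × ℂ × ℂ) : ‖p.2.1‖ ≤ gauge m n p ^ m := by
  have h := pow_le_pow_left₀ (by positivity)
    (le_max_left (‖p.2.1‖ ^ (m : ℝ)⁻¹) (‖p.2.2‖ ^ (n : ℝ)⁻¹)) m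
  rwa [Real.rpow_inv_natCast_pow (norm_nonneg _) hm.ne'] at h

theorem norm_snd_le_gauge (hn : 0 < n) (p : ℂ × ℂ × ℂ) : ‖p.2.2‖ ≤ gauge m n p ^ n := by
  have h := pow_le_pow_left₀ (by positivity)
    (le_max_right (‖p.2.1‖ ^ (m : ℝ)⁻¹) (‖p.2.2‖ ^ (n : ℝ)⁻¹)) n
  rwa [Real.rpow_inv_natCast_pow (norm_nonneg _) hn.ne'] at h

theorem gauge_pow_eq (hm : 0 < m) (p : ℂ × ℂ × ℂ) :
    gauge m n p ^ m = max ‖p.2.1‖ ((‖p.2.2‖ ^ (n : ℝ)⁻¹) ^ m) := by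
  rw [gauge, (pow_left_monotoneOn (n := m)).map_max (show (0 : ℝ) ≤ _ by positivity)
    (show (0 : ℝ) ≤ _ by positivity), Real.rpow_inv_natCast_pow (norm_nonneg _) hm.ne']

theorem gauge_pos {p : ℂ × ℂ × ℂ} (hp : p.2 ≠ 0) : 0 < gauge m n p := by
  rw [gauge, lt_max_iff]
  by_contra! h
  have h1 : ‖p.2.1‖ = 0 := by
    by_contra h0
    exact absurd h.1 (not_le.2 (Real.rpow_pos_of_pos
      (lt_of_le_of_ne (norm_nonneg _) (Ne.symm h0)) _))
  have h2 : ‖p.2.2‖ = 0 := by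
    by_contra h0
    exact absurd h.2 (not_le.2 (Real.rpow_pos_of_pos
      (lt_of_le_of_ne (norm_nonneg _) (Ne.symm h0)) _))
  exact hp (Prod.ext (norm_eq_zero.1 h1) (norm_eq_zero.1 h2))

theorem gauge_le_one {p : ℂ × ℂ × ℂ} (hp : ‖p.2‖ ≤ 1) : gauge m n p ≤ 1 :=
  max_le (Real.rpow_le_one (norm_nonneg _) ((norm_fst_le _).trans hp) (by positivity))
    (Real.rpow_le_one (norm_nonneg _) ((norm_snd_le _).trans hp) (by positivity))

/-- On `[0, 1]`, the function `a ^ m` is a Lipschitz function of `a ^ n` when `n ≤ m`. -/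
theorem abs_pow_sub_pow_le (hn : 0 < n) (hnm : n ≤ m) {a b : ℝ} (ha : 0 ≤ a) (ha1 : a ≤ 1)
    (hb : 0 ≤ b) (hb1 : b ≤ 1) : |a ^ m - b ^ m| ≤ m * |a ^ n - b ^ n| := by
  wlog hab : b ≤ a generalizing a b
  · rw [abs_sub_comm, abs_sub_comm (a ^ n)]
    exact this hb hb1 ha ha1 (le_of_not_ge hab)
  rw [abs_of_nonneg (sub_nonneg.2 (pow_le_pow_left₀ hb hab _)),
    abs_of_nonneg (sub_nonneg.2 (pow_le_pow_left₀ hb hab _))]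
  have hs : 0 ≤ a - b := sub_nonneg.2 hab
  have h1 : a ^ m - b ^ m ≤ m * a ^ (m - 1) * (a - b) := by
    rw [← Commute.geom_sum₂_mul (Commute.all a b)]
    refine mul_le_mul_of_nonneg_right ?_ hs
    refine (Finset.sum_le_card_nsmul _ _ (a ^ (m - 1)) fun i hi => ?_).trans (by simp)
    have hi' := Finset.mem_range.1 hi
    calc a ^ i * b ^ (m - 1 - i) ≤ a ^ i * a ^ (m - 1 - i) := by gcongr
      _ = a ^ (m - 1) := by rw [← pow_add]; congr 1; omega
  have h2 : a ^ (n - 1) * (a - b) ≤ a ^ n - b ^ n := by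
    rw [← Commute.geom_sum₂_mul (Commute.all a b)]
    refine mul_le_mul_of_nonneg_right ?_ hs
    have := Finset.single_le_sum (f := fun i => a ^ i * b ^ (n - 1 - i))
      (fun i _ => by positivity) (Finset.mem_range.2 (Nat.sub_lt hn one_pos))
    simpa using this
  have h3 : a ^ (m - 1) ≤ a ^ (n - 1) := pow_le_pow_of_le_one ha ha1 (by omega)
  calc _ ≤ m * a ^ (m - 1) * (a - b) := h1
    _ ≤ m * a ^ (n - 1) * (a - b) := by gcongr
    _ = m * (a ^ (n - 1) * (a - b)) := by ring
    _ ≤ _ := by gcongr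

theorem isScale_gauge (hn : 0 < n) (hnm : n ≤ m) : IsScale fun p => gauge m n p ^ m where
  pos p hp := pow_pos (gauge_pos hp) _
  eq_zero p hp := by
    have hm : 0 < m := hn.trans_le hnm
    rw [gauge_pow_eq hm, hp]
    simp [hm.ne', hn.ne']
  le_norm p hp := by
    have hy : ‖p.2.2‖ ≤ 1 := (norm_snd_le p.2).trans hp
    rw [gauge_pow_eq (hn.trans_le hnm), Prod.norm_def]
    refine max_le_max le_rfl ?_
    refine (pow_le_pow_of_le_one (by positivity)
      (Real.rpow_le_one (norm_nonneg _) hy (by positivity)) hnm).trans ?_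
    rw [Real.rpow_inv_natCast_pow (norm_nonneg _) hn.ne']
  lipschitz := by
    have hm : 0 < m := hn.trans_le hnm
    have hm1 : (1 : ℝ) ≤ m := by exact_mod_cast hm
    refine ⟨m, by exact_mod_cast hm, fun p q hp hq => ?_⟩
    rw [gauge_pow_eq hm, gauge_pow_eq hm]
    have hx : ‖p.2.1 - q.2.1‖ ≤ ‖p - q‖ := (norm_fst_le (p.2 - q.2)).trans (norm_snd_le (p - q))
    have hy : ‖p.2.2 - q.2.2‖ ≤ ‖p - q‖ := (norm_snd_le (p.2 - q.2)).trans (norm_snd_le (p - q))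
    refine (abs_max_sub_max_le_max _ _ _ _).trans (max_le ?_ ?_)
    · refine (abs_norm_sub_norm_le _ _).trans (hx.trans ?_)
      nlinarith [norm_nonneg (p - q)]
    · have hp1 : ‖p.2.2‖ ≤ 1 := (norm_snd_le p.2).trans hp
      have hq1 : ‖q.2.2‖ ≤ 1 := (norm_snd_le q.2).trans hq
      refine (abs_pow_sub_pow_le hn hnm (by positivity)
        (Real.rpow_le_one (norm_nonneg _) hp1 (by positivity)) (by positivity)
        (Real.rpow_le_one (norm_nonneg _) hq1 (by positivity))).trans ?_
      rw [Real.rpow_inv_natCast_pow (norm_nonneg _) hn.ne',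
        Real.rpow_inv_natCast_pow (norm_nonneg _) hn.ne']
      gcongr
      exact (abs_norm_sub_norm_le _ _).trans hy

theorem gauge_pow_isBigO {a b : ℕ} (h : a ≤ b) :
    (fun p => gauge m n p ^ b) =O[puncturedNhds t₀] fun p => gauge m n p ^ a := by
  refine IsBigO.of_bound 1 ?_
  filter_upwards [eventually_norm_lt_puncturedNhds one_pos] with p hp
  have := gauge_nonneg (m := m) (n := n) p
  rw [Real.norm_of_nonneg (by positivity), Real.norm_of_nonneg (by positivity), one_mul]
  exact pow_le_pow_of_le_one this (gauge_le_one hp.le) h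

namespace Controlled

theorem mul_gauge {g₁ g₂ : ℂ × ℂ × ℂ → ℂ} {X : ℂ × ℂ × ℂ → ℝ} {a b c : ℕ}
    (h₁ : Controlled t₀ X (fun p => gauge m n p ^ a) g₁)
    (h₂ : Controlled t₀ X (fun p => gauge m n p ^ b) g₂) (hc : c ≤ a + b) :
    Controlled t₀ X (fun p => gauge m n p ^ c) fun p => g₁ p * g₂ p :=
  ((h₁.mul h₂).mono (EventuallyEq.isBigO (Eventually.of_forall fun p => by
    simp only [← pow_add]))).mono (gauge_pow_isBigO hc)

/-- Powers of the gauge are controlled even below the power `m`, where they may fail to be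
Lipschitz. -/
theorem gauge_pow (hn : 0 < n) (hnm : n ≤ m) (k : ℕ) :
    Controlled t₀ (fun p => gauge m n p ^ m) (fun p => gauge m n p ^ k)
      fun p => ((gauge m n p : ℝ) : ℂ) ^ k := by
  suffices Controlled t₀ (fun p => gauge m n p ^ m) (gauge m n)
      fun p => ((gauge m n p : ℝ) : ℂ) from this.pow k
  obtain ⟨L, hL, hXL⟩ := (isScale_gauge hn hnm).lipschitz
  refine ⟨IsBigO.of_bound 1 (Eventually.of_forall fun p => by simp), IsBigO.of_bound L ?_⟩
  filter_upwards [tendsto_fst_closePairs.eventually eventually_ne_zero_puncturedNhds,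
    tendsto_fst_closePairs.eventually (eventually_norm_lt_puncturedNhds one_pos),
    tendsto_snd_closePairs.eventually (eventually_norm_lt_puncturedNhds one_pos)] with z h0 h1 h2
  have hpos := gauge_pos (m := m) (n := n) h0
  have h3 := hXL z.1 z.2 h1.le h2.le
  rw [← Complex.ofReal_sub, Complex.norm_real, Real.norm_eq_abs, relDist, norm_mul, norm_div,
    norm_norm, Real.norm_of_nonneg hpos.le, Real.norm_of_nonneg (pow_pos hpos m).le, mul_div_assoc',
    mul_div_assoc', le_div_iff₀ (pow_pos hpos m)]
  -- `|a - b| a ^ (m - 1) ≤ |a ^ m - b ^ m|` turns the Lipschitz bound for the scale into one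
  -- for the gauge
  have h4 : ∀ a b : ℝ, 0 ≤ a → 0 ≤ b → |a - b| * a ^ m ≤ a * |a ^ m - b ^ m| := by
    intro a b ha hb
    have hm : 0 < m := hn.trans_le hnm
    rw [← Commute.geom_sum₂_mul (Commute.all a b), abs_mul, mul_comm |a - b|, ← mul_assoc]
    refine mul_le_mul_of_nonneg_right ?_ (abs_nonneg _)
    rw [abs_of_nonneg (Finset.sum_nonneg fun i _ => by positivity)]
    have := Finset.single_le_sum (f := fun i => a ^ i * b ^ (m - 1 - i))
      (fun i _ => by positivity) (Finset.mem_range.2 (Nat.sub_lt hm one_pos))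
    simp only [tsub_self, pow_zero, mul_one] at this
    calc a ^ m = a * a ^ (m - 1) := by rw [← pow_succ']; congr 1; omega
      _ ≤ _ := by gcongr
  calc _ ≤ gauge m n z.1 * |gauge m n z.1 ^ m - gauge m n z.2 ^ m| :=
        h4 _ _ (gauge_nonneg _) (gauge_nonneg _)
    _ ≤ gauge m n z.1 * (L * ‖z.1 - z.2‖) := by gcongr
    _ = _ := by ring

theorem param (hn : 0 < n) (hnm : n ≤ m) :
    Controlled t₀ (fun p => gauge m n p ^ m) (fun _ => 1) fun p => p.1 := by
  refine of_lipschitz (isScale_gauge hn hnm) (L := 1) (fun p q _ _ => ?_) ?_ ?_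
  · rw [one_mul]
    exact norm_fst_le (p - q)
  · exact tendsto_fst_puncturedNhds.isBigO_one ℝ
  · simpa using gauge_pow_isBigO (Nat.zero_le m)

theorem fst (hn : 0 < n) (hnm : n ≤ m) :
    Controlled t₀ (fun p => gauge m n p ^ m) (fun p => gauge m n p ^ m) fun p => p.2.1 := by
  refine of_lipschitz (isScale_gauge hn hnm) (L := 1) (fun p q _ _ => ?_) ?_ (isBigO_refl _ _)
  · rw [one_mul]
    exact (norm_fst_le (p.2 - q.2)).trans (norm_snd_le (p - q))
  · refine IsBigO.of_bound 1 (Eventually.of_forall fun p => ?_)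
    rw [Real.norm_of_nonneg (pow_nonneg (gauge_nonneg p) _), one_mul]
    exact norm_fst_le_gauge (hn.trans_le hnm) p

theorem snd (hn : 0 < n) (hnm : n ≤ m) :
    Controlled t₀ (fun p => gauge m n p ^ m) (fun p => gauge m n p ^ n) fun p => p.2.2 := by
  refine of_lipschitz (isScale_gauge hn hnm) (L := 1) (fun p q _ _ => ?_) ?_
    (gauge_pow_isBigO hnm)
  · rw [one_mul]
    exact (norm_snd_le (p.2 - q.2)).trans (norm_snd_le (p - q))
  · refine IsBigO.of_bound 1 (Eventually.of_forall fun p => ?_)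
    rw [Real.norm_of_nonneg (pow_nonneg (gauge_nonneg p) _), one_mul]
    exact norm_snd_le_gauge hn p

theorem monomial (hn : 0 < n) (hnm : n ≤ m) (c : ℂ) {i j e : ℕ} (he : e ≤ m * i + n * j) :
    Controlled t₀ (fun p => gauge m n p ^ m) (fun p => gauge m n p ^ e)
      fun p => c * p.2.1 ^ i * p.2.2 ^ j := by
  have h1 := ((fst (t₀ := t₀) hn hnm).pow i).const_mul c
  have h2 := (snd (t₀ := t₀) hn hnm).pow j
  simp only [← pow_mul] at h1 h2
  exact h1.mul_gauge h2 he

theorem param_monomial (hn : 0 < n) (hnm : n ≤ m) (c : ℂ) {i j e : ℕ} (he : e ≤ m * i + n * j) :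
    Controlled t₀ (fun p => gauge m n p ^ m) (fun p => gauge m n p ^ e)
      fun p => c * p.1 * p.2.1 ^ i * p.2.2 ^ j := by
  have := (param (t₀ := t₀) hn hnm).mul (monomial (t₀ := t₀) hn hnm c he)
  simp only [one_mul] at this
  exact this.congr fun p => by ring

end Controlled

/-- A pair of functions whose weighted initial forms have no common zero outside the origin
satisfies the lower bound expected from its weighted orders: by homogeneity, it is enough to bound
the initial forms from below on the compact set `max |u| |v| = 1`. -/
theorem exists_gauge_lower_bound (hm : 0 < m) (hn : 0 < n) {g₁ g₂ : ℂ × ℂ × ℂ → ℂ}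
    {P₁ P₂ : ℂ × ℝ × ℂ × ℂ → ℂ} (hP₁ : Continuous P₁) (hP₂ : Continuous P₂) {k₁ k₂ e₁ e₂ k : ℕ}
    (hk₁ : e₁ + k₁ = k) (hk₂ : e₂ + k₂ = k)
    (h₁ : ∀ t (r : ℝ) u v, g₁ (t, r ^ m * u, r ^ n * v) = r ^ k₁ * P₁ (t, r, u, v))
    (h₂ : ∀ t (r : ℝ) u v, g₂ (t, r ^ m * u, r ^ n * v) = r ^ k₂ * P₂ (t, r, u, v))
    (h0 : ∀ u v, P₁ (t₀, 0, u, v) = 0 → P₂ (t₀, 0, u, v) = 0 → u = 0 ∧ v = 0) :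
    ∃ c > 0, ∀ᶠ p in puncturedNhds t₀, c * gauge m n p ^ k ≤
      ‖(gauge m n p : ℂ) ^ e₁ * g₁ p‖ + ‖(gauge m n p : ℂ) ^ e₂ * g₂ p‖ := by
  let Q : (ℂ × ℝ) × ℂ × ℂ → ℝ := fun a =>
    ‖P₁ (a.1.1, a.1.2, a.2)‖ + ‖P₂ (a.1.1, a.1.2, a.2)‖
  have hQ : Continuous Q := by fun_prop
  have hcpt : IsCompact (sphere (0 : ℂ × ℂ) 1) := isCompact_sphere _ _
  have hQpos : ∀ w ∈ sphere (0 : ℂ × ℂ) 1, 0 < Q ((t₀, 0), w) := by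
    intro w hw
    have hnn : 0 ≤ Q ((t₀, 0), w) := by positivity
    refine lt_of_le_of_ne hnn fun h => ?_
    have hz := (add_eq_zero_iff_of_nonneg (norm_nonneg _) (norm_nonneg _)).1 h.symm
    obtain ⟨hu, hv⟩ := h0 w.1 w.2 (norm_eq_zero.1 hz.1) (norm_eq_zero.1 hz.2)
    have : w = 0 := Prod.ext hu hv
    simp [this] at hw
  obtain ⟨c, hc, hcQ⟩ : ∃ c > 0, ∀ w ∈ sphere (0 : ℂ × ℂ) 1, c < Q ((t₀, 0), w) := by
    have hne : (sphere (0 : ℂ × ℂ) 1).Nonempty := ⟨(1, 0), by simp [Prod.norm_def]⟩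
    obtain ⟨w, hw, hmin⟩ := hcpt.exists_isMinOn hne
      (hQ.comp (by fun_prop : Continuous fun w : ℂ × ℂ => (((t₀, 0), w) : (ℂ × ℝ) × ℂ × ℂ))
        ).continuousOn
    have := hQpos w hw
    exact ⟨Q ((t₀, 0), w) / 2, by positivity, fun w' hw' =>
      (half_lt_self this).trans_le (hmin hw')⟩
  obtain ⟨u, v, hu, hv, hu0, hvs, huv⟩ := generalized_tube_lemma
    (isCompact_singleton (x := (t₀, (0 : ℝ)))) hcpt
    (isOpen_lt continuous_const hQ : IsOpen {a | c < Q a}) (by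
      rintro ⟨a, w⟩ ⟨ha, hw⟩
      obtain rfl : a = (t₀, 0) := ha
      exact hcQ w hw)
  have hgauge : Tendsto (gauge m n) (puncturedNhds t₀) (𝓝 0) := by
    have hc : Continuous (gauge m n) := by
      unfold gauge
      exact ((by fun_prop : Continuous fun p : ℂ × ℂ × ℂ => ‖p.2.1‖).rpow_const
        fun _ => Or.inr (by positivity)).max
        ((by fun_prop : Continuous fun p : ℂ × ℂ × ℂ => ‖p.2.2‖).rpow_const
        fun _ => Or.inr (by positivity))
    refine (hc.tendsto' (t₀, 0) 0 ?_).mono_left nhdsWithin_le_nhds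
    simp [gauge, hm.ne', hn.ne']
  refine ⟨c, hc, ?_⟩
  filter_upwards [(tendsto_fst_puncturedNhds.prodMk_nhds hgauge).eventually
    (hu.mem_nhds (hu0 rfl)), eventually_ne_zero_puncturedNhds] with p hp hp0
  have hN := gauge_pos (m := m) (n := n) hp0
  set N := gauge m n p with hNd
  have hNC : (N : ℂ) ≠ 0 := by exact_mod_cast hN.ne'
  have hw : (p.2.1 / N ^ m, p.2.2 / N ^ n) ∈ sphere (0 : ℂ × ℂ) 1 := by
    rw [mem_sphere_zero_iff_norm, Prod.norm_def]
    simp only [norm_div, norm_pow, Complex.norm_real, Real.norm_of_nonneg hN.le]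
    refine le_antisymm (max_le ?_ ?_) ?_
    · rw [div_le_one (by positivity)]; exact norm_fst_le_gauge hm p
    · rw [div_le_one (by positivity)]; exact norm_snd_le_gauge hn p
    · rcases max_choice (‖p.2.1‖ ^ (m : ℝ)⁻¹) (‖p.2.2‖ ^ (n : ℝ)⁻¹) with h | h
      · refine le_max_of_le_left ?_
        rw [hNd, gauge, h, Real.rpow_inv_natCast_pow (norm_nonneg _) hm.ne', div_self]
        intro h'
        rw [hNd, gauge, h, h', Real.zero_rpow (by simp [hm.ne'])] at hN
        exact lt_irrefl _ hN
      · refine le_max_of_le_right ?_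
        rw [hNd, gauge, h, Real.rpow_inv_natCast_pow (norm_nonneg _) hn.ne', div_self]
        intro h'
        rw [hNd, gauge, h, h', Real.zero_rpow (by simp [hn.ne'])] at hN
        exact lt_irrefl _ hN
  have hlow : c < Q ((p.1, N), (p.2.1 / N ^ m, p.2.2 / N ^ n)) := huv ⟨hp, hvs hw⟩
  have hpe : p = (p.1, (N : ℂ) ^ m * (p.2.1 / N ^ m), (N : ℂ) ^ n * (p.2.2 / N ^ n)) := by
    rw [mul_div_cancel₀ _ (pow_ne_zero _ hNC), mul_div_cancel₀ _ (pow_ne_zero _ hNC)]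
  have e₁ := congrArg g₁ hpe
  have e₂ := congrArg g₂ hpe
  rw [h₁] at e₁
  rw [h₂] at e₂
  rw [e₁, e₂, ← mul_assoc, ← mul_assoc, ← pow_add, ← pow_add, hk₁, hk₂, norm_mul, norm_mul,
    norm_pow, Complex.norm_real, Real.norm_of_nonneg hN.le, ← mul_add, mul_comm]
  gcongr

end gauge

/-! ### Families with isolated weighted initial form -/

/-- If the weighted initial form of degree `d` of the family has an isolated critical point, then
the family is Lipschitz trivial as soon as `∂f/∂t` has weighted order `e` at least `d + m - n`.
The functions `P₁`, `P₂` extend `r ^ (-k₁) fx (t, rᵐ u, rⁿ v)` and `r ^ (-k₂) fy (t, rᵐ u, rⁿ v)`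
to `r = 0`, where they are the derivatives of the initial form. -/
theorem isLipschitzTrivial_of_weighted {f : ℂ → ℂ → ℂ → ℂ} {ft fx fy : ℂ × ℂ × ℂ → ℂ}
    (hf : HasPartials f ft fx fy) (hft : ∀ t, ft (t, 0) = 0) {m n d e k₁ k₂ : ℕ} (hn : 0 < n)
    (hnm : n ≤ m) (hk₁ : m + k₁ = d) (hk₂ : n + k₂ = d) (he : d + m ≤ e + n)
    {P₁ P₂ : ℂ × ℝ × ℂ × ℂ → ℂ} (hP₁ : Continuous P₁) (hP₂ : Continuous P₂)
    (h₁ : ∀ t (r : ℝ) u v, fx (t, r ^ m * u, r ^ n * v) = r ^ k₁ * P₁ (t, r, u, v))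
    (h₂ : ∀ t (r : ℝ) u v, fy (t, r ^ m * u, r ^ n * v) = r ^ k₂ * P₂ (t, r, u, v))
    (h0 : ∀ t u v, P₁ (t, 0, u, v) = 0 → P₂ (t, 0, u, v) = 0 → u = 0 ∧ v = 0)
    (ht : ∀ t₀, Controlled t₀ (fun p => gauge m n p ^ m) (fun p => gauge m n p ^ e) ft)
    (hx : ∀ t₀, Controlled t₀ (fun p => gauge m n p ^ m) (fun p => gauge m n p ^ k₁) fx)
    (hy : ∀ t₀, Controlled t₀ (fun p => gauge m n p ^ m) (fun p => gauge m n p ^ k₂) fy) :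
    IsLipschitzTrivial f := by
  refine isLipschitzTrivial_of_frame hf hft (isScale_gauge hn hnm) (M := fun p => gauge m n p ^ d)
    (A₀ := fun _ => 0) (B₀ := fun _ => 0) (a₁ := fun p => (gauge m n p : ℂ) ^ m)
    (b₁ := fun _ => 0) (a₂ := fun _ => 0) (b₂ := fun p => (gauge m n p : ℂ) ^ n)
    contDiff_const contDiff_const (fun _ => rfl) (fun _ => rfl)
    (fun p hp => pow_pos (gauge_pos hp) _) fun t₀ => ?_
  have hz : Controlled t₀ (fun p => gauge m n p ^ m)
      (fun p => gauge m n p ^ d * gauge m n p ^ m) (fun _ => 0) :=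
    ⟨isBigO_zero _ _, by simpa using isBigO_zero _ _⟩
  have hm := hn.trans_le hnm
  simp only [zero_mul, mul_zero, add_zero, zero_add]
  refine ⟨(Controlled.gauge_pow hn hnm m).mul_gauge (hx t₀) hk₁.ge,
    (Controlled.gauge_pow hn hnm n).mul_gauge (hy t₀) hk₂.ge,
    exists_gauge_lower_bound hm hn hP₁ hP₂ hk₁ hk₂ h₁ h₂ (h0 t₀), ?_, hz, hz, ?_⟩
  · simp only [← pow_add]
    exact (ht t₀).mul_gauge (Controlled.gauge_pow hn hnm m) (by omega)
  · simp only [← pow_add]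
    exact (ht t₀).mul_gauge (Controlled.gauge_pow hn hnm n) he

/-- The initial form is `y (x³ + s x² y² + y⁶)`, of degree `7` for the weights `2`, `1`; the cubic
`X³ + s X² + 1` has discriminant `-(4 s³ + 27)`. -/
theorem isLipschitzTrivial_Z_1_0 {s : ℂ} (hs : 4 * s ^ 3 + 27 ≠ 0) :
    IsLipschitzTrivial (Z_1_0 s) := by
  refine isLipschitzTrivial_of_weighted (m := 2) (n := 1) (d := 7) (e := 8) (k₁ := 5) (k₂ := 6)
    (ft := fun p => p.2.1 * p.2.2 ^ 6)
    (fx := fun p => 3 * p.2.1 ^ 2 * p.2.2 + 2 * s * p.2.1 * p.2.2 ^ 3 + p.1 * p.2.2 ^ 6)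
    (fy := fun p => p.2.1 ^ 3 + 3 * s * p.2.1 ^ 2 * p.2.2 ^ 2 + 6 * p.1 * p.2.1 * p.2.2 ^ 5 +
      7 * p.2.2 ^ 6)
    (P₁ := fun a => 3 * a.2.2.1 ^ 2 * a.2.2.2 + 2 * s * a.2.2.1 * a.2.2.2 ^ 3 +
      a.2.1 * a.1 * a.2.2.2 ^ 6)
    (P₂ := fun a => a.2.2.1 ^ 3 + 3 * s * a.2.2.1 ^ 2 * a.2.2.2 ^ 2 +
      6 * a.2.1 * a.1 * a.2.2.1 * a.2.2.2 ^ 5 + 7 * a.2.2.2 ^ 6)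
    ?_ (by simp) (by norm_num) (by norm_num) (by norm_num) (by norm_num) (by norm_num)
    (by fun_prop) (by fun_prop) (fun t r u v => by ring) (fun t r u v => by ring) ?_ ?_ ?_ ?_
  · intro T X Y T' X' Y' S τ hT hX hY
    refine (((((hX.pow 3).mul hY).add (((hX.pow 2).const_mul s).mul (hY.pow 3))).add
      ((hT.mul hX).mul (hY.pow 6))).add (hY.pow 7)).congr_deriv ?_
    simp
    ring
  · intro t u v h1 h2
    simp only [Complex.ofReal_zero, zero_mul, mul_zero, add_zero] at h1 h2
    have h3 : u * v * (3 * u + 2 * s * v ^ 2) = 0 := by linear_combination h1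
    rcases mul_eq_zero.1 h3 with h3 | h3
    · rcases mul_eq_zero.1 h3 with rfl | rfl <;> simpa using h2
    · have h4 : (4 * s ^ 3 + 27) * v ^ 6 = 0 := by
        linear_combination (27 / 7) * h2 - (1 / 7) *
          (9 * u ^ 2 + 21 * s * u * v ^ 2 - 14 * s ^ 2 * v ^ 4) * h3
      have hv : v = 0 := by simpa using (mul_eq_zero.1 h4).resolve_left hs
      subst hv
      exact ⟨by simpa using h3, rfl⟩
  · intro t₀
    exact (Controlled.monomial (by norm_num) (by norm_num) 1 (i := 1) (j := 6) (by norm_num)).congr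
      fun p => by ring
  · intro t₀
    exact ((((Controlled.monomial (by norm_num) (by norm_num) 3 (i := 2) (j := 1)
      (by norm_num)).add (Controlled.monomial (by norm_num) (by norm_num) (2 * s) (i := 1) (j := 3)
      (by norm_num))).add (Controlled.param_monomial (by norm_num) (by norm_num) 1 (i := 0)
      (j := 6) (by norm_num)))).congr fun p => by ring
  · intro t₀
    exact ((((Controlled.monomial (by norm_num) (by norm_num) 1 (i := 3) (j := 0)
      (by norm_num)).add (Controlled.monomial (by norm_num) (by norm_num) (3 * s) (i := 2) (j := 2)
      (by norm_num))).add (Controlled.param_monomial (by norm_num) (by norm_num) 6 (i := 1)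
      (j := 5) (by norm_num))).add (Controlled.monomial (by norm_num) (by norm_num) 7 (i := 0)
      (j := 6) (by norm_num))).congr fun p => by ring

/-- The initial form is `x³ y + y⁸`, of degree `24` for the weights `7`, `3`. -/
theorem isLipschitzTrivial_Z_17 (s : ℂ) : IsLipschitzTrivial (Z_17 s) := by
  refine isLipschitzTrivial_of_weighted (m := 7) (n := 3) (d := 24) (e := 28) (k₁ := 17) (k₂ := 21)
    (ft := fun p => p.2.1 * p.2.2 ^ 7)
    (fx := fun p => 3 * p.2.1 ^ 2 * p.2.2 + s * p.2.2 ^ 6 + p.1 * p.2.2 ^ 7)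
    (fy := fun p => p.2.1 ^ 3 + 8 * p.2.2 ^ 7 + 6 * s * p.2.1 * p.2.2 ^ 5 +
      7 * p.1 * p.2.1 * p.2.2 ^ 6)
    (P₁ := fun a => 3 * a.2.2.1 ^ 2 * a.2.2.2 + a.2.1 * s * a.2.2.2 ^ 6 +
      a.2.1 ^ 4 * a.1 * a.2.2.2 ^ 7)
    (P₂ := fun a => a.2.2.1 ^ 3 + 8 * a.2.2.2 ^ 7 + 6 * a.2.1 * s * a.2.2.1 * a.2.2.2 ^ 5 +
      7 * a.2.1 ^ 4 * a.1 * a.2.2.1 * a.2.2.2 ^ 6)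
    ?_ (by simp) (by norm_num) (by norm_num) (by norm_num) (by norm_num) (by norm_num)
    (by fun_prop) (by fun_prop) (fun t r u v => by ring) (fun t r u v => by ring) ?_ ?_ ?_ ?_
  · intro T X Y T' X' Y' S τ hT hX hY
    refine (((((hX.pow 3).mul hY).add (hY.pow 8)).add ((hX.const_mul s).mul (hY.pow 6))).add
      ((hT.mul hX).mul (hY.pow 7))).congr_deriv ?_
    simp
    ring
  · intro t u v h1 h2
    simp only [Complex.ofReal_zero, zero_mul, mul_zero, add_zero, ne_eq, OfNat.ofNat_ne_zero,
      not_false_eq_true, zero_pow] at h1 h2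
    have h3 : u ^ 2 * v = 0 := by linear_combination h1 / 3
    rcases mul_eq_zero.1 h3 with h3 | rfl
    · obtain rfl : u = 0 := by simpa using h3
      simpa using h2
    · simpa using h2
  · intro t₀
    exact (Controlled.monomial (by norm_num) (by norm_num) 1 (i := 1) (j := 7) (by norm_num)).congr
      fun p => by ring
  · intro t₀
    exact ((((Controlled.monomial (by norm_num) (by norm_num) 3 (i := 2) (j := 1)
      (by norm_num)).add (Controlled.monomial (by norm_num) (by norm_num) s (i := 0) (j := 6)
      (by norm_num))).add (Controlled.param_monomial (by norm_num) (by norm_num) 1 (i := 0)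
      (j := 7) (by norm_num)))).congr fun p => by ring
  · intro t₀
    exact ((((Controlled.monomial (by norm_num) (by norm_num) 1 (i := 3) (j := 0)
      (by norm_num)).add (Controlled.monomial (by norm_num) (by norm_num) 8 (i := 0) (j := 7)
      (by norm_num))).add (Controlled.monomial (by norm_num) (by norm_num) (6 * s) (i := 1)
      (j := 5) (by norm_num))).add (Controlled.param_monomial (by norm_num) (by norm_num) 7 (i := 1)
      (j := 6) (by norm_num))).congr fun p => by ring

/-- The initial form is `x⁴ + s x² y³ + y⁶`, of degree `12` for the weights `3`, `2`. -/
theorem isLipschitzTrivial_W_1_0 {s : ℂ} (hs : s ^ 2 ≠ 4) : IsLipschitzTrivial (W_1_0 s) := by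
  refine isLipschitzTrivial_of_weighted (m := 3) (n := 2) (d := 12) (e := 14) (k₁ := 9) (k₂ := 10)
    (ft := fun p => p.2.1 ^ 2 * p.2.2 ^ 4)
    (fx := fun p => 4 * p.2.1 ^ 3 + 2 * s * p.2.1 * p.2.2 ^ 3 + 2 * p.1 * p.2.1 * p.2.2 ^ 4)
    (fy := fun p => 3 * s * p.2.1 ^ 2 * p.2.2 ^ 2 + 4 * p.1 * p.2.1 ^ 2 * p.2.2 ^ 3 +
      6 * p.2.2 ^ 5)
    (P₁ := fun a => 4 * a.2.2.1 ^ 3 + 2 * s * a.2.2.1 * a.2.2.2 ^ 3 +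
      2 * a.2.1 ^ 2 * a.1 * a.2.2.1 * a.2.2.2 ^ 4)
    (P₂ := fun a => 3 * s * a.2.2.1 ^ 2 * a.2.2.2 ^ 2 +
      4 * a.2.1 ^ 2 * a.1 * a.2.2.1 ^ 2 * a.2.2.2 ^ 3 + 6 * a.2.2.2 ^ 5)
    ?_ (by simp) (by norm_num) (by norm_num) (by norm_num) (by norm_num) (by norm_num)
    (by fun_prop) (by fun_prop) (fun t r u v => by ring) (fun t r u v => by ring) ?_ ?_ ?_ ?_
  · intro T X Y T' X' Y' S τ hT hX hY
    refine ((((hX.pow 4).add (((hX.pow 2).const_mul s).mul (hY.pow 3))).add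
      ((hT.mul (hX.pow 2)).mul (hY.pow 4))).add (hY.pow 6)).congr_deriv ?_
    simp
    ring
  · intro t u v h1 h2
    simp only [Complex.ofReal_zero, zero_mul, mul_zero, add_zero, ne_eq, OfNat.ofNat_ne_zero,
      not_false_eq_true, zero_pow] at h1 h2
    have h3 : u * (2 * u ^ 2 + s * v ^ 3) = 0 := by linear_combination h1 / 2
    rcases mul_eq_zero.1 h3 with rfl | h3
    · simpa using h2
    · have h4 : (s ^ 2 - 4) * v ^ 5 = 0 := by
        linear_combination s * v ^ 2 * h3 - (2 / 3) * h2
      have hv : v = 0 := by simpa using (mul_eq_zero.1 h4).resolve_left (sub_ne_zero.2 hs)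
      subst hv
      exact ⟨by simpa using h3, rfl⟩
  · intro t₀
    exact (Controlled.monomial (by norm_num) (by norm_num) 1 (i := 2) (j := 4) (by norm_num)).congr
      fun p => by ring
  · intro t₀
    exact ((((Controlled.monomial (by norm_num) (by norm_num) 4 (i := 3) (j := 0)
      (by norm_num)).add (Controlled.monomial (by norm_num) (by norm_num) (2 * s) (i := 1) (j := 3)
      (by norm_num))).add (Controlled.param_monomial (by norm_num) (by norm_num) 2 (i := 1)
      (j := 4) (by norm_num)))).congr fun p => by ring
  · intro t₀
    exact ((((Controlled.monomial (by norm_num) (by norm_num) (3 * s) (i := 2) (j := 2)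
      (by norm_num)).add (Controlled.param_monomial (by norm_num) (by norm_num) 4 (i := 2) (j := 3)
      (by norm_num))).add (Controlled.monomial (by norm_num) (by norm_num) 6 (i := 0)
      (j := 5) (by norm_num)))).congr fun p => by ring

/-- The initial form is `x⁴ + x y⁵`, of degree `20` for the weights `5`, `3`. -/
theorem isLipschitzTrivial_W_17 (s : ℂ) : IsLipschitzTrivial (W_17 s) := by
  refine isLipschitzTrivial_of_weighted (m := 5) (n := 3) (d := 20) (e := 24) (k₁ := 15) (k₂ := 17)
    (ft := fun p => p.2.2 ^ 8)
    (fx := fun p => 4 * p.2.1 ^ 3 + p.2.2 ^ 5)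
    (fy := fun p => 5 * p.2.1 * p.2.2 ^ 4 + 7 * s * p.2.2 ^ 6 + 8 * p.1 * p.2.2 ^ 7)
    (P₁ := fun a => 4 * a.2.2.1 ^ 3 + a.2.2.2 ^ 5)
    (P₂ := fun a => 5 * a.2.2.1 * a.2.2.2 ^ 4 + 7 * a.2.1 * s * a.2.2.2 ^ 6 +
      8 * a.2.1 ^ 4 * a.1 * a.2.2.2 ^ 7)
    ?_ (by simp) (by norm_num) (by norm_num) (by norm_num) (by norm_num) (by norm_num)
    (by fun_prop) (by fun_prop) (fun t r u v => by ring) (fun t r u v => by ring) ?_ ?_ ?_ ?_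
  · intro T X Y T' X' Y' S τ hT hX hY
    refine ((((hX.pow 4).add (hX.mul (hY.pow 5))).add ((hY.pow 7).const_mul s)).add
      (hT.mul (hY.pow 8))).congr_deriv ?_
    simp
    ring
  · intro t u v h1 h2
    simp only [Complex.ofReal_zero, zero_mul, mul_zero, add_zero, ne_eq, OfNat.ofNat_ne_zero,
      not_false_eq_true, zero_pow] at h1 h2
    have h3 : u * v ^ 4 = 0 := by linear_combination h2 / 5
    rcases mul_eq_zero.1 h3 with rfl | h3
    · simpa using h1
    · obtain rfl : v = 0 := by simpa using h3
      simpa using h1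
  · intro t₀
    exact (Controlled.monomial (by norm_num) (by norm_num) 1 (i := 0) (j := 8) (by norm_num)).congr
      fun p => by ring
  · intro t₀
    exact ((Controlled.monomial (by norm_num) (by norm_num) 4 (i := 3) (j := 0)
      (by norm_num)).add (Controlled.monomial (by norm_num) (by norm_num) 1 (i := 0) (j := 5)
      (by norm_num))).congr fun p => by ring
  · intro t₀
    exact ((((Controlled.monomial (by norm_num) (by norm_num) 5 (i := 1) (j := 4)
      (by norm_num)).add (Controlled.monomial (by norm_num) (by norm_num) (7 * s) (i := 0) (j := 6)
      (by norm_num))).add (Controlled.param_monomial (by norm_num) (by norm_num) 8 (i := 0)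
      (j := 7) (by norm_num)))).congr fun p => by ring

/-- The initial form is `x⁴ + y⁷`, of degree `28` for the weights `7`, `4`. -/
theorem isLipschitzTrivial_W_18 (s : ℂ) : IsLipschitzTrivial (W_18 s) := by
  refine isLipschitzTrivial_of_weighted (m := 7) (n := 4) (d := 28) (e := 34) (k₁ := 21) (k₂ := 24)
    (ft := fun p => p.2.1 ^ 2 * p.2.2 ^ 5)
    (fx := fun p => 4 * p.2.1 ^ 3 + 2 * s * p.2.1 * p.2.2 ^ 4 + 2 * p.1 * p.2.1 * p.2.2 ^ 5)
    (fy := fun p => 7 * p.2.2 ^ 6 + 4 * s * p.2.1 ^ 2 * p.2.2 ^ 3 +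
      5 * p.1 * p.2.1 ^ 2 * p.2.2 ^ 4)
    (P₁ := fun a => 4 * a.2.2.1 ^ 3 + 2 * a.2.1 ^ 2 * s * a.2.2.1 * a.2.2.2 ^ 4 +
      2 * a.2.1 ^ 6 * a.1 * a.2.2.1 * a.2.2.2 ^ 5)
    (P₂ := fun a => 7 * a.2.2.2 ^ 6 + 4 * a.2.1 ^ 2 * s * a.2.2.1 ^ 2 * a.2.2.2 ^ 3 +
      5 * a.2.1 ^ 6 * a.1 * a.2.2.1 ^ 2 * a.2.2.2 ^ 4)
    ?_ (by simp) (by norm_num) (by norm_num) (by norm_num) (by norm_num) (by norm_num)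
    (by fun_prop) (by fun_prop) (fun t r u v => by ring) (fun t r u v => by ring) ?_ ?_ ?_ ?_
  · intro T X Y T' X' Y' S τ hT hX hY
    refine ((((hX.pow 4).add (hY.pow 7)).add (((hX.pow 2).const_mul s).mul (hY.pow 4))).add
      ((hT.mul (hX.pow 2)).mul (hY.pow 5))).congr_deriv ?_
    simp
    ring
  · intro t u v h1 h2
    simp only [Complex.ofReal_zero, zero_mul, mul_zero, add_zero, ne_eq, OfNat.ofNat_ne_zero,
      not_false_eq_true, zero_pow] at h1 h2
    exact ⟨by simpa using h1, by simpa using h2⟩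
  · intro t₀
    exact (Controlled.monomial (by norm_num) (by norm_num) 1 (i := 2) (j := 5) (by norm_num)).congr
      fun p => by ring
  · intro t₀
    exact ((((Controlled.monomial (by norm_num) (by norm_num) 4 (i := 3) (j := 0)
      (by norm_num)).add (Controlled.monomial (by norm_num) (by norm_num) (2 * s) (i := 1) (j := 4)
      (by norm_num))).add (Controlled.param_monomial (by norm_num) (by norm_num) 2 (i := 1)
      (j := 5) (by norm_num)))).congr fun p => by ring
  · intro t₀
    exact ((((Controlled.monomial (by norm_num) (by norm_num) 7 (i := 0) (j := 6)
      (by norm_num)).add (Controlled.monomial (by norm_num) (by norm_num) (4 * s) (i := 2) (j := 3)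
      (by norm_num))).add (Controlled.param_monomial (by norm_num) (by norm_num) 5 (i := 2)
      (j := 4) (by norm_num)))).congr fun p => by ring

/-! ### Families whose initial form is the square of a cusp -/

/-- Families with weighted initial form `(x² + y³)²`, for the weights `3`, `2`. The frame consists
of the Euler field `3x ∂x + 2y ∂y`, which detects `(x² + y³)²`, and of the Hamiltonian field
`3y² ∂x - 2x ∂y`, which is tangent to the cusp and detects the next term. The Euler field is multiplied
by a power of the gauge so that both derivatives have the same order. -/
theorem isLipschitzTrivial_of_cusp {f : ℂ → ℂ → ℂ → ℂ} {ft fx fy : ℂ × ℂ × ℂ → ℂ}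
    (hf : HasPartials f ft fx fy) (hft : ∀ t, ft (t, 0) = 0) {l k : ℕ} (hk : 12 + l = k)
    {g₁ g₂ : ℂ × ℂ × ℂ → ℂ} {P₁ P₂ : ℂ × ℝ × ℂ × ℂ → ℂ}
    (hg₁ : ∀ p, 3 * p.2.1 * fx p + 2 * p.2.2 * fy p = g₁ p)
    (hg₂ : ∀ p, 3 * p.2.2 ^ 2 * fx p + -2 * p.2.1 * fy p = g₂ p)
    (hP₁ : Continuous P₁) (hP₂ : Continuous P₂)
    (h₁ : ∀ t (r : ℝ) u v, g₁ (t, r ^ 3 * u, r ^ 2 * v) = r ^ 12 * P₁ (t, r, u, v))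
    (h₂ : ∀ t (r : ℝ) u v, g₂ (t, r ^ 3 * u, r ^ 2 * v) = r ^ k * P₂ (t, r, u, v))
    (h0 : ∀ t u v, P₁ (t, 0, u, v) = 0 → P₂ (t, 0, u, v) = 0 → u = 0 ∧ v = 0)
    (ht : ∀ t₀, Controlled t₀ (fun p => gauge 3 2 p ^ 3) (fun p => gauge 3 2 p ^ (k + 1)) ft)
    (hc₁ : ∀ t₀, Controlled t₀ (fun p => gauge 3 2 p ^ 3) (fun p => gauge 3 2 p ^ 12) g₁)
    (hc₂ : ∀ t₀, Controlled t₀ (fun p => gauge 3 2 p ^ 3) (fun p => gauge 3 2 p ^ k) g₂) :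
    IsLipschitzTrivial f := by
  refine isLipschitzTrivial_of_frame hf hft (isScale_gauge (m := 3) (n := 2) two_pos (by norm_num))
    (M := fun p => gauge 3 2 p ^ k) (A₀ := fun _ => 0) (B₀ := fun _ => 0)
    (a₁ := fun p => (gauge 3 2 p : ℂ) ^ l * (3 * p.2.1))
    (b₁ := fun p => (gauge 3 2 p : ℂ) ^ l * (2 * p.2.2))
    (a₂ := fun p => 3 * p.2.2 ^ 2) (b₂ := fun p => -2 * p.2.1)
    contDiff_const contDiff_const (fun _ => rfl) (fun _ => rfl)
    (fun p hp => pow_pos (gauge_pos hp) _) fun t₀ => ?_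
  have e₁ : ∀ p : ℂ × ℂ × ℂ, (gauge 3 2 p : ℂ) ^ l * (3 * p.2.1) * fx p +
      (gauge 3 2 p : ℂ) ^ l * (2 * p.2.2) * fy p = (gauge 3 2 p : ℂ) ^ l * g₁ p := fun p => by
    rw [← hg₁]; ring
  have hG := Controlled.gauge_pow (t₀ := t₀) (m := 3) (n := 2) two_pos (by norm_num) l
  have hx := Controlled.fst (t₀ := t₀) (m := 3) (n := 2) two_pos (by norm_num)
  have hy := Controlled.snd (t₀ := t₀) (m := 3) (n := 2) two_pos (by norm_num)
  have hy2 : Controlled t₀ (fun p => gauge 3 2 p ^ 3) (fun p => gauge 3 2 p ^ 4)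
      fun p => p.2.2 * p.2.2 := hy.mul_gauge hy le_rfl
  simp only [zero_mul, add_zero, hg₂, e₁, ← pow_add]
  refine ⟨hG.mul_gauge (hc₁ t₀) (by omega), hc₂ t₀, ?_, ?_, ?_, ?_, ?_⟩
  · simpa using exists_gauge_lower_bound (e₁ := l) (e₂ := 0) (by norm_num) two_pos hP₁ hP₂
      (by omega) (zero_add k) h₁ h₂ (h0 t₀)
  · exact (ht t₀).mul_gauge (hG.mul_gauge (hx.const_mul 3) le_rfl) (by omega)
  · exact (ht t₀).mul_gauge (hG.mul_gauge (hy.const_mul 2) le_rfl) (by omega)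
  · exact ((ht t₀).mul_gauge (hy2.const_mul 3) (by omega)).congr fun p => by ring
  · exact (ht t₀).mul_gauge (hx.const_mul (-2)) (by omega)

/-- On the cusp `x² = -y³` the Hamiltonian field maps `s x y^(4+q)` to `s (2q + 11) y^(q+6)`. -/
theorem isLipschitzTrivial_W_sharp_odd {q : ℕ} (hq : 0 < q) {s : ℂ} (hs : s ≠ 0) :
    IsLipschitzTrivial (W_sharp_odd q s) := by
  -- writing `q + 1` for `q` makes all exponents below sums
  obtain ⟨q, rfl⟩ : ∃ k, q = k + 1 := ⟨q - 1, by omega⟩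
  refine isLipschitzTrivial_of_cusp (l := 2 * q + 2) (k := 2 * q + 14)
    (ft := fun p => p.2.1 * p.2.2 ^ (q + 6))
    (fx := fun p => 4 * p.2.1 * (p.2.1 ^ 2 + p.2.2 ^ 3) + s * p.2.2 ^ (q + 5) +
      p.1 * p.2.2 ^ (q + 6))
    (fy := fun p => 6 * p.2.2 ^ 2 * (p.2.1 ^ 2 + p.2.2 ^ 3) +
      s * (q + 5) * p.2.1 * p.2.2 ^ (q + 4) + (q + 6) * p.1 * p.2.1 * p.2.2 ^ (q + 5))
    (g₁ := fun p => 12 * (p.2.1 ^ 2 + p.2.2 ^ 3) ^ 2 + s * (2 * q + 13) * p.2.1 * p.2.2 ^ (q + 5) +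
      (2 * q + 15) * p.1 * p.2.1 * p.2.2 ^ (q + 6))
    (g₂ := fun p => s * p.2.2 ^ (q + 4) * (3 * p.2.2 ^ 3 - 2 * (q + 5) * p.2.1 ^ 2) +
      p.1 * p.2.2 ^ (q + 5) * (3 * p.2.2 ^ 3 - 2 * (q + 6) * p.2.1 ^ 2))
    (P₁ := fun a => 12 * (a.2.2.1 ^ 2 + a.2.2.2 ^ 3) ^ 2 +
      a.2.1 ^ (2 * q + 1) * s * (2 * q + 13) * a.2.2.1 * a.2.2.2 ^ (q + 5) +
      a.2.1 ^ (2 * q + 3) * (2 * q + 15) * a.1 * a.2.2.1 * a.2.2.2 ^ (q + 6))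
    (P₂ := fun a => s * a.2.2.2 ^ (q + 4) * (3 * a.2.2.2 ^ 3 - 2 * (q + 5) * a.2.2.1 ^ 2) +
      a.2.1 ^ 2 * a.1 * a.2.2.2 ^ (q + 5) * (3 * a.2.2.2 ^ 3 - 2 * (q + 6) * a.2.2.1 ^ 2))
    ?_ (by simp) (by ring) (fun p => by ring) (fun p => by ring) (by fun_prop) (by fun_prop)
    (fun t r u v => by ring) (fun t r u v => by ring) ?_ ?_ ?_ ?_
  · intro T X Y T' X' Y' S τ hT hX hY
    refine (((((hX.pow 2).add (hY.pow 3)).pow 2).add ((hX.const_mul s).mul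
      (hY.pow (4 + (q + 1))))).add ((hT.mul hX).mul (hY.pow (5 + (q + 1))))).congr_deriv ?_
    rw [show 4 + (q + 1) - 1 = q + 4 by omega, show 5 + (q + 1) - 1 = q + 5 by omega]
    push_cast
    simp only [Pi.add_apply, Pi.pow_apply, Pi.mul_apply]
    ring
  · intro t u v h1 h2
    simp only [Complex.ofReal_zero, zero_mul, add_zero, ne_eq, OfNat.ofNat_ne_zero,
      not_false_eq_true, zero_pow, Nat.add_eq_zero_iff, one_ne_zero, and_false] at h1 h2
    have h3 : u ^ 2 + v ^ 3 = 0 := by simpa using h1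
    have hq0 : (2 * q + 13 : ℂ) ≠ 0 := by exact_mod_cast (by omega : 2 * q + 13 ≠ 0)
    have h4 : s * (2 * q + 13) * v ^ (q + 7) = 0 := by
      linear_combination h2 + 2 * s * (q + 5) * v ^ (q + 4) * h3
    obtain rfl : v = 0 := by simpa [hs, hq0] using h4
    exact ⟨by simpa using h3, rfl⟩
  · intro t₀
    exact (Controlled.monomial (by norm_num) (by norm_num) 1 (i := 1) (j := q + 6)
      (by omega)).congr fun p => by ring
  · intro t₀
    exact (((((Controlled.monomial (by norm_num) (by norm_num) 12 (i := 4) (j := 0)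
      (by norm_num)).add (Controlled.monomial (by norm_num) (by norm_num) 24 (i := 2) (j := 3)
      (by norm_num))).add (Controlled.monomial (by norm_num) (by norm_num) 12 (i := 0) (j := 6)
      (by norm_num))).add (Controlled.monomial (by norm_num) (by norm_num) (s * (2 * q + 13))
      (i := 1) (j := q + 5) (by omega))).add (Controlled.param_monomial (by norm_num) (by norm_num)
      (2 * q + 15) (i := 1) (j := q + 6) (by omega))).congr fun p => by ring
  · intro t₀
    exact ((((Controlled.monomial (by norm_num) (by norm_num) (3 * s) (i := 0) (j := q + 7)
      (by omega)).add (Controlled.monomial (by norm_num) (by norm_num) (-(2 * s * (q + 5)))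
      (i := 2) (j := q + 4) (by omega))).add (Controlled.param_monomial (by norm_num) (by norm_num)
      3 (i := 0) (j := q + 8) (by omega))).add (Controlled.param_monomial (by norm_num)
      (by norm_num) (-(2 * (q + 6))) (i := 2) (j := q + 5) (by omega))).congr fun p => by ring

/-- On the cusp `x² = -y³` the Hamiltonian field maps `s x² y^(3+q)` to
`2 s (q + 6) x y^(q+5)`. -/
theorem isLipschitzTrivial_W_sharp_even {q : ℕ} (hq : 0 < q) {s : ℂ} (hs : s ≠ 0) :
    IsLipschitzTrivial (W_sharp_even q s) := by
  obtain ⟨q, rfl⟩ : ∃ k, q = k + 1 := ⟨q - 1, by omega⟩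
  refine isLipschitzTrivial_of_cusp (l := 2 * q + 3) (k := 2 * q + 15)
    (ft := fun p => p.2.1 ^ 2 * p.2.2 ^ (q + 5))
    (fx := fun p => 4 * p.2.1 * (p.2.1 ^ 2 + p.2.2 ^ 3) + 2 * s * p.2.1 * p.2.2 ^ (q + 4) +
      2 * p.1 * p.2.1 * p.2.2 ^ (q + 5))
    (fy := fun p => 6 * p.2.2 ^ 2 * (p.2.1 ^ 2 + p.2.2 ^ 3) +
      s * (q + 4) * p.2.1 ^ 2 * p.2.2 ^ (q + 3) + (q + 5) * p.1 * p.2.1 ^ 2 * p.2.2 ^ (q + 4))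
    (g₁ := fun p => 12 * (p.2.1 ^ 2 + p.2.2 ^ 3) ^ 2 +
      s * (2 * q + 14) * p.2.1 ^ 2 * p.2.2 ^ (q + 4) +
      (2 * q + 16) * p.1 * p.2.1 ^ 2 * p.2.2 ^ (q + 5))
    (g₂ := fun p => 2 * s * p.2.1 * p.2.2 ^ (q + 3) * (3 * p.2.2 ^ 3 - (q + 4) * p.2.1 ^ 2) +
      2 * p.1 * p.2.1 * p.2.2 ^ (q + 4) * (3 * p.2.2 ^ 3 - (q + 5) * p.2.1 ^ 2))
    (P₁ := fun a => 12 * (a.2.2.1 ^ 2 + a.2.2.2 ^ 3) ^ 2 +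
      a.2.1 ^ (2 * q + 2) * s * (2 * q + 14) * a.2.2.1 ^ 2 * a.2.2.2 ^ (q + 4) +
      a.2.1 ^ (2 * q + 4) * (2 * q + 16) * a.1 * a.2.2.1 ^ 2 * a.2.2.2 ^ (q + 5))
    (P₂ := fun a => 2 * s * a.2.2.1 * a.2.2.2 ^ (q + 3) *
      (3 * a.2.2.2 ^ 3 - (q + 4) * a.2.2.1 ^ 2) + 2 * a.2.1 ^ 2 * a.1 * a.2.2.1 *
      a.2.2.2 ^ (q + 4) * (3 * a.2.2.2 ^ 3 - (q + 5) * a.2.2.1 ^ 2))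
    ?_ (by simp) (by ring) (fun p => by ring) (fun p => by ring) (by fun_prop) (by fun_prop)
    (fun t r u v => by ring) (fun t r u v => by ring) ?_ ?_ ?_ ?_
  · intro T X Y T' X' Y' S τ hT hX hY
    refine (((((hX.pow 2).add (hY.pow 3)).pow 2).add (((hX.pow 2).const_mul s).mul
      (hY.pow (3 + (q + 1))))).add ((hT.mul (hX.pow 2)).mul (hY.pow (4 + (q + 1))))).congr_deriv ?_
    rw [show 3 + (q + 1) - 1 = q + 3 by omega, show 4 + (q + 1) - 1 = q + 4 by omega]
    push_cast
    simp only [Pi.add_apply, Pi.pow_apply, Pi.mul_apply]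
    ring
  · intro t u v h1 h2
    simp only [Complex.ofReal_zero, zero_mul, mul_zero, add_zero, ne_eq, OfNat.ofNat_ne_zero,
      not_false_eq_true, zero_pow, Nat.add_eq_zero_iff, and_false] at h1 h2
    have h3 : u ^ 2 + v ^ 3 = 0 := by simpa using h1
    have hq0 : (q + 7 : ℂ) ≠ 0 := by exact_mod_cast (by omega : q + 7 ≠ 0)
    have h4 : s * (q + 7) * (u * v ^ (q + 6)) = 0 := by
      linear_combination h2 / 2 + s * (q + 4) * u * v ^ (q + 3) * h3
    have h5 : u = 0 ∨ v = 0 := by simpa [hs, hq0] using h4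
    rcases h5 with rfl | rfl
    · exact ⟨rfl, by simpa using h3⟩
    · exact ⟨by simpa using h3, rfl⟩
  · intro t₀
    exact (Controlled.monomial (by norm_num) (by norm_num) 1 (i := 2) (j := q + 5)
      (by omega)).congr fun p => by ring
  · intro t₀
    exact (((((Controlled.monomial (by norm_num) (by norm_num) 12 (i := 4) (j := 0)
      (by norm_num)).add (Controlled.monomial (by norm_num) (by norm_num) 24 (i := 2) (j := 3)
      (by norm_num))).add (Controlled.monomial (by norm_num) (by norm_num) 12 (i := 0) (j := 6)
      (by norm_num))).add (Controlled.monomial (by norm_num) (by norm_num) (s * (2 * q + 14))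
      (i := 2) (j := q + 4) (by omega))).add (Controlled.param_monomial (by norm_num) (by norm_num)
      (2 * q + 16) (i := 2) (j := q + 5) (by omega))).congr fun p => by ring
  · intro t₀
    exact ((((Controlled.monomial (by norm_num) (by norm_num) (6 * s) (i := 1) (j := q + 6)
      (by omega)).add (Controlled.monomial (by norm_num) (by norm_num) (-(2 * s * (q + 4)))
      (i := 3) (j := q + 3) (by omega))).add (Controlled.param_monomial (by norm_num) (by norm_num)
      6 (i := 1) (j := q + 7) (by omega))).add (Controlled.param_monomial (by norm_num)
      (by norm_num) (-(2 * (q + 5))) (i := 3) (j := q + 4) (by omega))).congr fun p => by ring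

/-! ### Families whose Newton polygon has two edges -/

/-- Lower bound for the derivatives of `x⁴ + x²y³ + …`, in terms of `α = |x|`, `β = |y|` and the
second scale `w`. The numbers `A`, `B` stand for `|4x² + 2y³|` and `|3x² + a y^j|`, the
derivatives divided by `x` and `y²`, where `w² = |y|^j`. Where `α` dominates `w` the initial form
`x⁴ + x²y³` of the first edge decides; elsewhere the one of the second edge does. -/
theorem exists_lower_bound_quartic {σ τ : ℝ} (hσ : 0 < σ) (hτ : 0 < τ) :
    ∃ c > 0, ∃ κ > 0, ∀ α β w A B : ℝ, 0 ≤ α → 0 ≤ β → 0 ≤ w → α ≤ 1 → w ^ 2 ≤ κ * β ^ 3 →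
      0 ≤ A → 0 ≤ B → 4 * α ^ 2 - 2 * β ^ 3 ≤ A → 2 * β ^ 3 - 4 * α ^ 2 ≤ A →
      3 * α ^ 2 - τ * w ^ 2 ≤ B → σ * w ^ 2 - 3 * α ^ 2 ≤ B →
      c * (max α w ^ 2 * (max α w ^ 2 + max α β ^ 3)) ≤
        max α w * (α * A) + max α β * (β ^ 2 * B) := by
  obtain ⟨C, hC, hC1⟩ : ∃ C : ℝ, 1 ≤ C ∧ 1 ≤ C * τ :=
    ⟨1 + 1 / τ, by have : 0 < 1 / τ := by positivity
                   linarith, by rw [add_mul, one_div_mul_cancel hτ.ne']; linarith⟩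
  set D := 1 + τ with hD
  have hD0 : 0 < D := by positivity
  refine ⟨min (1 / (C * (C + 1))) (σ / (6 * (D * (D + 2)))), by positivity, 1 / (4 * τ + 1),
    by positivity, ?_⟩
  intro α β w A B hα hβ hw hα1 hwβ hA hB hA1 hA2 hB1 hB2
  have hκ : τ * w ^ 2 ≤ β ^ 3 / 4 ∧ w ^ 2 ≤ β ^ 3 := by
    rw [one_div_mul_eq_div, le_div_iff₀ (by positivity)] at hwβ
    have : 0 ≤ τ * w ^ 2 := by positivity
    constructor <;> nlinarith [sq_nonneg w]
  have hX2 : max α w ^ 2 ≤ α ^ 2 ∨ max α w ^ 2 ≤ w ^ 2 := by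
    rcases max_choice α w with h | h <;> rw [h] <;> simp
  have hY3 : max α β ^ 3 ≤ α ^ 2 + β ^ 3 := by
    have : α ^ 3 ≤ α ^ 2 := pow_le_pow_of_le_one hα hα1 (by norm_num)
    have h1 : 0 ≤ α ^ 2 := by positivity
    have h2 : 0 ≤ β ^ 3 := by positivity
    rcases max_choice α β with h | h <;> rw [h] <;> linarith
  have hS : α ^ 2 * A + β ^ 3 * B ≤ max α w * (α * A) + max α β * (β ^ 2 * B) := by
    have h1 : α * (α * A) ≤ max α w * (α * A) := by gcongr; exact le_max_left _ _
    have h2 : β * (β ^ 2 * B) ≤ max α β * (β ^ 2 * B) := by gcongr; exact le_max_right _ _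
    nlinarith
  have hXY0 : 0 ≤ max α w ^ 2 * (max α w ^ 2 + max α β ^ 3) := by positivity
  have hβ3 : 0 ≤ β ^ 3 := by positivity
  have hα2 : 0 ≤ α ^ 2 := by positivity
  refine le_trans ?_ hS
  rcases le_or_gt (τ * w ^ 2) (α ^ 2) with h | h
  · have hX : max α w ^ 2 ≤ C * α ^ 2 := by
      rcases hX2 with h' | h'
      · nlinarith
      · nlinarith [sq_nonneg w]
    have hlow : α ^ 2 * (α ^ 2 + β ^ 3) ≤ α ^ 2 * A + β ^ 3 * B := by
      have h1 : α ^ 2 * (4 * α ^ 2 - 2 * β ^ 3) ≤ α ^ 2 * A := by gcongr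
      have h2 : β ^ 3 * (2 * α ^ 2) ≤ β ^ 3 * B := by gcongr; linarith
      have h3 : 0 ≤ α ^ 2 * A := by positivity
      nlinarith
    calc _ ≤ 1 / (C * (C + 1)) * (max α w ^ 2 * (max α w ^ 2 + max α β ^ 3)) := by
          gcongr; exact min_le_left _ _
      _ ≤ 1 / (C * (C + 1)) * (C * α ^ 2 * ((C + 1) * (α ^ 2 + β ^ 3))) := by
          gcongr
          nlinarith
      _ = α ^ 2 * (α ^ 2 + β ^ 3) := by field_simp
      _ ≤ _ := hlow
  · have hX : max α w ^ 2 ≤ D * w ^ 2 := by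
      rcases hX2 with h' | h' <;> nlinarith [sq_nonneg w]
    have hM : max α w ^ 2 * (max α w ^ 2 + max α β ^ 3) ≤
        D * w ^ 2 * ((D + 2) * β ^ 3) := by
      gcongr
      nlinarith [hκ.1, hκ.2]
    have hlow : σ / 6 * (w ^ 2 * β ^ 3) ≤ α ^ 2 * A + β ^ 3 * B := by
      have h1 : 0 ≤ α ^ 2 * A := by positivity
      have h2 : 0 ≤ β ^ 3 * B := by positivity
      rcases le_or_gt (6 * α ^ 2) (σ * w ^ 2) with h' | h'
      · have h3 : β ^ 3 * (σ / 6 * w ^ 2) ≤ β ^ 3 * B := by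
          gcongr
          nlinarith [sq_nonneg w]
        linarith
      · have h3 : (σ / 6 * w ^ 2) * β ^ 3 ≤ α ^ 2 * A := by
          gcongr
          · linarith
          · linarith [hκ.1]
        linarith
    calc _ ≤ σ / (6 * (D * (D + 2))) * (D * w ^ 2 * ((D + 2) * β ^ 3)) := by
          gcongr; exact min_le_right _ _
      _ = σ / 6 * (w ^ 2 * β ^ 3) := by field_simp
      _ ≤ _ := hlow

/-- The lower bound of `exists_lower_bound_cubic` where `α` dominates the second scale `w`. The
numbers `A`, `Q`, `B` stand for `|3x + 2y²|`, `|x + 3y²|` and `|∂f/∂y|`, and `α β A` for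
`|∂f/∂x|`. The forms `3x + 2y²`, `x + 3y²` of the first edge are linearly independent in `x`,
`y²`, so that `A + Q` dominates `α + β²`. -/
theorem cubic_lower_bound_first_edge {τ C : ℝ} (hC : 1 ≤ C) (hC1 : 1 ≤ C * (2 * τ))
    {α β w A Q B : ℝ} (hα : 0 ≤ α) (hβ : 0 ≤ β) (hw : 0 ≤ w) (hα1 : α ≤ 1) (hβ1 : β ≤ 1 / 8)
    (hA : 0 ≤ A) (h1 : 7 * α ≤ 3 * A + 2 * Q) (h2 : 7 * β ^ 2 ≤ A + 3 * Q)
    (h4 : α - 3 * β ^ 2 ≤ Q) (hB1 : α ^ 2 * Q - τ * w ^ 2 * β ^ 2 ≤ B)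
    (h : 2 * τ * w ^ 2 ≤ α ^ 2) :
    1 / (4 * C ^ 3) * (max α w ^ 2 * max α β * (max α w + max α β ^ 2)) ≤
      max α w * (α * β * A) + max α β * B := by
  have hX0 : 0 ≤ max α w := le_max_of_le_left hα
  have hX1 : α * (α * β * A) ≤ max α w * (α * β * A) := by gcongr; exact le_max_left _ _
  have hX : max α w ≤ C * α := by
    refine max_le (le_mul_of_one_le_left hα hC) ?_
    refine (sq_le_sq₀ hw (by positivity)).1 ?_
    calc w ^ 2 ≤ (C * (2 * τ)) * w ^ 2 := le_mul_of_one_le_left (sq_nonneg w) hC1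
      _ = C * (2 * τ * w ^ 2) := by ring
      _ ≤ C * α ^ 2 := by gcongr
      _ ≤ C * (C * α ^ 2) := le_mul_of_one_le_left (by positivity) hC
      _ = (C * α) ^ 2 := by ring
  have hB3 : α ^ 2 * (Q - β ^ 2 / 2) ≤ B := by
    have : 2 * τ * w ^ 2 * β ^ 2 ≤ α ^ 2 * β ^ 2 := by gcongr
    linarith
  rcases le_total α β with hαβ | hαβ
  · rw [max_eq_right hαβ]
    calc _ ≤ 1 / (4 * C ^ 3) * ((C * α) ^ 2 * β * (C * α + C * β ^ 2)) := by
          gcongr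
          exact le_mul_of_one_le_left (sq_nonneg β) hC
      _ = α ^ 2 * β * ((α + β ^ 2) / 4) := by field_simp
      _ ≤ α ^ 2 * β * (A + Q - β ^ 2 / 2) := by gcongr; linarith
      _ = α * (α * β * A) + β * (α ^ 2 * (Q - β ^ 2 / 2)) := by ring
      _ ≤ _ := by gcongr
  · rw [max_eq_left hαβ]
    have hβα : β ^ 2 ≤ α / 8 := by
      calc β ^ 2 = β * β := sq β
        _ ≤ 1 / 8 * α := by gcongr
        _ = _ := by ring
    have hαC : α ^ 2 ≤ C * α := by
      calc α ^ 2 = α * α := sq α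
        _ ≤ C * α := by gcongr; linarith
    calc _ ≤ 1 / (4 * C ^ 3) * ((C * α) ^ 2 * α * (C * α + C * α)) := by gcongr
      _ = α * (α ^ 2 * (α / 2)) := by field_simp; ring
      _ ≤ α * (α ^ 2 * (Q - β ^ 2 / 2)) := by gcongr; linarith
      _ ≤ α * B := by gcongr
      _ ≤ _ := le_add_of_nonneg_left (by positivity)

/-- The lower bound of `exists_lower_bound_cubic` where the second scale `w` dominates `α`. There
`α` is small compared with `β²`, so that `A` is comparable with `β²`; either the term
`σ w² β²` dominates `α² Q` in `B`, or `α` is comparable with `w` and `α β A` is large enough. -/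
theorem cubic_lower_bound_second_edge {σ τ D : ℝ} (hσ : 0 < σ) (hD : D = 1 + 2 * τ)
    (hτ : 0 < τ) {α β w A Q B : ℝ} (hα : 0 ≤ α) (hβ : 0 ≤ β) (hw : 0 ≤ w) (hβ1 : β ≤ 1 / 8)
    (hDw : D * w ≤ β ^ 2 / 6) (hA : 0 ≤ A) (hB : 0 ≤ B) (h3 : 2 * β ^ 2 - 3 * α ≤ A)
    (h5 : Q ≤ α + 3 * β ^ 2) (hB2 : σ * w ^ 2 * β ^ 2 - α ^ 2 * Q ≤ B)
    (h : α ^ 2 < 2 * τ * w ^ 2) :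
    σ / (32 * D) * (max α w ^ 2 * max α β * (max α w + max α β ^ 2)) ≤
      max α w * (α * β * A) + max α β * B := by
  have hD1 : 1 ≤ D := by rw [hD]; linarith
  have hX0 : 0 ≤ max α w := le_max_of_le_left hα
  have hX1 : α * (α * β * A) ≤ max α w * (α * β * A) := by gcongr; exact le_max_left _ _
  have hX2 : max α w ^ 2 ≤ D * w ^ 2 := by
    have := sq_nonneg w
    have h0 : 0 ≤ 2 * τ * w ^ 2 := by positivity
    have hDe : D * w ^ 2 = w ^ 2 + 2 * τ * w ^ 2 := by rw [hD]; ring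
    rcases max_choice α w with h' | h' <;> rw [h'] <;> linarith
  have hX : max α w ≤ D * w := by
    refine (sq_le_sq₀ hX0 (by positivity)).1 (hX2.trans ?_)
    calc D * w ^ 2 ≤ D * (D * w ^ 2) := le_mul_of_one_le_left (by positivity) hD1
      _ = (D * w) ^ 2 := by ring
  have hα6 : α ≤ β ^ 2 / 6 := ((le_max_left _ _).trans hX).trans hDw
  have hββ : β ^ 2 ≤ β := by
    calc β ^ 2 = β * β := sq β
      _ ≤ 1 * β := by gcongr; linarith
      _ = β := one_mul β
  rw [max_eq_right (by linarith : α ≤ β)]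
  have hlow : σ / 16 * (w ^ 2 * β ^ 3) ≤ max α w * (α * β * A) + β * B := by
    refine le_trans ?_ (add_le_add_left hX1 _)
    have e1 : 0 ≤ α * (α * β * A) := by positivity
    have e2 : 0 ≤ β * B := by positivity
    have e5 : 0 ≤ σ * (w ^ 2 * β ^ 3) := by positivity
    rcases le_or_gt (8 * α ^ 2) (σ * w ^ 2) with h' | h'
    · have e3 : α ^ 2 * Q ≤ σ / 2 * w ^ 2 * β ^ 2 := by
        calc α ^ 2 * Q ≤ α ^ 2 * (4 * β ^ 2) := by gcongr; linarith
          _ = 8 * α ^ 2 * (β ^ 2 / 2) := by ring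
          _ ≤ σ * w ^ 2 * (β ^ 2 / 2) := by gcongr
          _ = _ := by ring
      have e4 : β * (σ / 2 * w ^ 2 * β ^ 2) ≤ β * B := by gcongr; linarith
      have e6 : β * (σ / 2 * w ^ 2 * β ^ 2) = 1 / 2 * (σ * (w ^ 2 * β ^ 3)) := by ring
      linarith
    · have e3 : (σ / 8 * w ^ 2) * (β * β ^ 2) ≤ α ^ 2 * (β * A) := by
        gcongr <;> linarith
      have e6 : (σ / 8 * w ^ 2) * (β * β ^ 2) = 1 / 8 * (σ * (w ^ 2 * β ^ 3)) := by ring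
      have e7 : α ^ 2 * (β * A) = α * (α * β * A) := by ring
      linarith
  calc _ ≤ σ / (32 * D) * (D * w ^ 2 * β * (2 * β ^ 2)) := by
        gcongr
        linarith
    _ = σ / 16 * (w ^ 2 * β ^ 3) := by field_simp; ring
    _ ≤ _ := hlow

/-- Lower bound for the derivatives of `x³y + x²y³ + …`, in terms of `α = |x|`, `β = |y|`
and the second scale `w`; see `cubic_lower_bound_first_edge` for `A`, `Q`, `B`. -/
theorem exists_lower_bound_cubic {σ τ : ℝ} (hσ : 0 < σ) (hτ : 0 < τ) :
    ∃ c > 0, ∃ κ > 0, ∀ α β w A Q B : ℝ, 0 ≤ α → 0 ≤ β → 0 ≤ w → α ≤ 1 → β ≤ 1 / 8 →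
      w ≤ κ * β ^ 2 → 0 ≤ A → 0 ≤ B → 7 * α ≤ 3 * A + 2 * Q → 7 * β ^ 2 ≤ A + 3 * Q →
      2 * β ^ 2 - 3 * α ≤ A → α - 3 * β ^ 2 ≤ Q → Q ≤ α + 3 * β ^ 2 →
      α ^ 2 * Q - τ * w ^ 2 * β ^ 2 ≤ B → σ * w ^ 2 * β ^ 2 - α ^ 2 * Q ≤ B →
      c * (max α w ^ 2 * max α β * (max α w + max α β ^ 2)) ≤
        max α w * (α * β * A) + max α β * B := by
  obtain ⟨C, hC, hC1⟩ : ∃ C : ℝ, 1 ≤ C ∧ 1 ≤ C * (2 * τ) :=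
    ⟨1 + 1 / (2 * τ), by have : 0 < 1 / (2 * τ) := by positivity
                         linarith,
      by rw [add_mul, one_div_mul_cancel (by positivity)]; linarith⟩
  obtain ⟨D, hD⟩ : ∃ D : ℝ, D = 1 + 2 * τ := ⟨_, rfl⟩
  have hD0 : 0 < D := by rw [hD]; positivity
  refine ⟨min (1 / (4 * C ^ 3)) (σ / (32 * D)), by positivity, 1 / (6 * D), by positivity, ?_⟩
  intro α β w A Q B hα hβ hw hα1 hβ1 hwβ hA hB h1 h2 h3 h4 h5 hB1 hB2
  have hX0 : 0 ≤ max α w := le_max_of_le_left hα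
  have hY0 : 0 ≤ max α β := le_max_of_le_left hα
  rcases le_or_gt (2 * τ * w ^ 2) (α ^ 2) with h | h
  · exact le_trans (by gcongr; exact min_le_left _ _) (cubic_lower_bound_first_edge hC hC1 hα hβ hw
      hα1 hβ1 hA h1 h2 h4 hB1 h)
  · have hDw : D * w ≤ β ^ 2 / 6 := by
      rw [one_div_mul_eq_div, le_div_iff₀ (by positivity)] at hwβ
      linarith
    exact le_trans (by gcongr; exact min_le_right _ _) (cubic_lower_bound_second_edge hσ hD hτ hα
      hβ hw hβ1 hDw hA hB h3 h5 hB2 h)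

section

variable {m n : ℕ} {t₀ : ℂ} {μ : ℝ → ℝ → ℝ}

/-- The scales `X = gauge m n ^ m` and `Y = ‖(x, y)‖` satisfy `Yᵐ ≤ Xⁿ`. -/
theorem norm_pow_le_gauge_pow (hn : 0 < n) (hnm : n ≤ m) {p : ℂ × ℂ × ℂ} (hp : ‖p.2‖ ≤ 1) :
    ‖p.2‖ ^ m ≤ (gauge m n p ^ m) ^ n := by
  have hx := norm_fst_le_gauge (n := n) (hn.trans_le hnm) p
  have hy := norm_snd_le_gauge (m := m) hn p
  rw [Prod.norm_def, (pow_left_monotoneOn (n := m)).map_max (norm_nonneg p.2.1)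
    (norm_nonneg p.2.2)]
  refine max_le ?_ ?_
  · exact (pow_le_pow_of_le_one (norm_nonneg _) ((norm_fst_le p.2).trans hp) hnm).trans (by gcongr)
  · rw [← pow_mul, mul_comm, pow_mul]
    gcongr

/-- Monomials in `t, x, y`, in the scale `X = gauge m n ^ m` and in `Y = ‖(x, y)‖` are controlled by
any function of `X` and `Y` that dominates the corresponding monomial in `X` and `Y`
on the range of `(X, Y)`. -/
theorem Controlled.mixed_monomial (hn : 0 < n) (hnm : n ≤ m) (c : ℂ) (e a b i j : ℕ)
    (hμ : ∀ X Y : ℝ, 0 ≤ X → X ≤ Y → Y ≤ 1 → Y ^ m ≤ X ^ n → X ^ (a + i) * Y ^ (b + j) ≤ μ X Y) :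
    Controlled t₀ (fun p => gauge m n p ^ m) (fun p => μ (gauge m n p ^ m) ‖p.2‖)
      fun p => c * p.1 ^ e * ((gauge m n p : ℂ) ^ m) ^ a * (‖p.2‖ : ℂ) ^ b *
        p.2.1 ^ i * p.2.2 ^ j := by
  have hX := isScale_gauge hn hnm
  have hXY : (fun p => gauge m n p ^ m) =O[puncturedNhds t₀] fun p => ‖p.2‖ := by
    refine IsBigO.of_bound 1 ?_
    filter_upwards [eventually_norm_lt_puncturedNhds one_pos] with p hp
    rw [Real.norm_of_nonneg (pow_nonneg (gauge_nonneg p) _), norm_norm, one_mul]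
    exact hX.le_norm p hp.le
  have hY : Controlled t₀ (fun p => gauge m n p ^ m) (fun p => ‖p.2‖)
      fun p => ((‖p.2‖ : ℝ) : ℂ) := by
    refine Controlled.of_lipschitz hX (L := 1) (fun p q _ _ => ?_)
      (IsBigO.of_bound 1 (Eventually.of_forall fun p => by simp)) hXY
    rw [← Complex.ofReal_sub, Complex.norm_real, one_mul]
    exact (abs_norm_sub_norm_le _ _).trans (norm_snd_le (p - q))
  have hy : Controlled t₀ (fun p => gauge m n p ^ m) (fun p => ‖p.2‖) fun p => p.2.2 := by
    refine Controlled.of_lipschitz hX (L := 1) (fun p q _ _ => ?_)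
      (IsBigO.of_bound 1 (Eventually.of_forall fun p => ?_)) hXY
    · rw [one_mul]
      exact (norm_snd_le (p.2 - q.2)).trans (norm_snd_le (p - q))
    · rw [norm_norm, one_mul]
      exact norm_snd_le p.2
  have h := (((((Controlled.param (t₀ := t₀) hn hnm).pow e).const_mul c).mul
    ((Controlled.gauge_pow hn hnm m).pow a)).mul (hY.pow b)).mul
    ((Controlled.fst hn hnm).pow i) |>.mul (hy.pow j)
  refine h.mono (IsBigO.of_bound 1 ?_)
  filter_upwards [eventually_norm_lt_puncturedNhds one_pos] with p hp
  have hX0 : 0 ≤ gauge m n p ^ m := pow_nonneg (gauge_nonneg p) _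
  rw [Real.norm_of_nonneg (by positivity), one_mul]
  refine le_trans ?_ (le_abs_self _)
  refine le_trans (le_of_eq ?_) (hμ _ _ hX0 (hX.le_norm p hp.le) hp.le
    (norm_pow_le_gauge_pow hn hnm hp.le))
  ring

/-- The frame criterion for the frame `X ∂x`, `Y ∂y`, where `X = gauge m n ^ m` is the scale and
`Y = ‖(x, y)‖`. -/
theorem isLipschitzTrivial_of_two_scales {f : ℂ → ℂ → ℂ → ℂ} {ft fx fy : ℂ × ℂ × ℂ → ℂ}
    (hf : HasPartials f ft fx fy) (hft : ∀ t, ft (t, 0) = 0) (hn : 0 < n) (hnm : n ≤ m)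
    {A₀ B₀ : ℂ × ℂ × ℂ → ℂ} (hA₀ : ContDiff ℂ 1 A₀) (hB₀ : ContDiff ℂ 1 B₀)
    (hA₀0 : ∀ t, A₀ (t, 0) = 0) (hB₀0 : ∀ t, B₀ (t, 0) = 0)
    (hμ : ∀ X Y : ℝ, 0 < X → 0 < Y → 0 < μ X Y)
    (H : ∀ t₀ : ℂ,
      Controlled t₀ (fun p => gauge m n p ^ m) (fun p => μ (gauge m n p ^ m) ‖p.2‖)
        (fun p => (gauge m n p : ℂ) ^ m * fx p) ∧
      Controlled t₀ (fun p => gauge m n p ^ m) (fun p => μ (gauge m n p ^ m) ‖p.2‖)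
        (fun p => (‖p.2‖ : ℂ) * fy p) ∧
      (∃ c > 0, ∀ᶠ p in puncturedNhds t₀, c * μ (gauge m n p ^ m) ‖p.2‖ ≤
        gauge m n p ^ m * ‖fx p‖ + ‖p.2‖ * ‖fy p‖) ∧
      Controlled t₀ (fun p => gauge m n p ^ m)
        (fun p => μ (gauge m n p ^ m) ‖p.2‖ * gauge m n p ^ m)
        (fun p => (ft p + A₀ p * fx p + B₀ p * fy p) * (gauge m n p : ℂ) ^ m) ∧
      Controlled t₀ (fun p => gauge m n p ^ m)
        (fun p => μ (gauge m n p ^ m) ‖p.2‖ * gauge m n p ^ m)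
        (fun p => (ft p + A₀ p * fx p + B₀ p * fy p) * (‖p.2‖ : ℂ))) :
    IsLipschitzTrivial f := by
  refine isLipschitzTrivial_of_frame hf hft (isScale_gauge hn hnm)
    (M := fun p => μ (gauge m n p ^ m) ‖p.2‖)
    (a₁ := fun p => (gauge m n p : ℂ) ^ m) (b₁ := fun _ => 0) (a₂ := fun _ => 0)
    (b₂ := fun p => (‖p.2‖ : ℂ)) hA₀ hB₀ hA₀0 hB₀0
    (fun p hp => hμ _ _ (pow_pos (gauge_pos hp) _) (norm_pos_iff.2 hp)) fun t₀ => ?_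
  obtain ⟨h1, h2, ⟨c, hc, h3⟩, h4, h5⟩ := H t₀
  have hz : Controlled t₀ (fun p => gauge m n p ^ m)
      (fun p => μ (gauge m n p ^ m) ‖p.2‖ * gauge m n p ^ m) (fun _ => 0) :=
    ⟨isBigO_zero _ _, by simpa using isBigO_zero _ _⟩
  simp only [zero_mul, mul_zero, add_zero, zero_add]
  refine ⟨h1, h2, ⟨c, hc, h3.mono fun p hp => ?_⟩, h4, hz, hz, h5⟩
  rw [norm_mul, norm_mul, norm_pow, Complex.norm_real, Complex.norm_real, norm_norm,
    Real.norm_of_nonneg (gauge_nonneg p)]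
  exact hp

/-- Near `t = t₀`, `y = 0`, the function `a + b t y` has absolute value between `|a| / 2`
and `2 |a|`. -/
theorem eventually_norm_add_mul {a b : ℂ} (ha : a ≠ 0) :
    ∀ᶠ p in puncturedNhds t₀, ‖a‖ / 2 ≤ ‖a + b * p.1 * p.2.2‖ ∧
      ‖a + b * p.1 * p.2.2‖ ≤ 2 * ‖a‖ := by
  have h : Tendsto (fun p : ℂ × ℂ × ℂ => ‖a + b * p.1 * p.2.2‖) (puncturedNhds t₀) (𝓝 ‖a‖) := by
    refine (Continuous.tendsto' (by fun_prop) (t₀, 0) ‖a‖ ?_).mono_left nhdsWithin_le_nhds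
    simp
  have ha' := norm_pos_iff.2 ha
  filter_upwards [h.eventually (eventually_ge_nhds (half_lt_self ha')),
    h.eventually (eventually_le_nhds (show ‖a‖ < 2 * ‖a‖ by linarith))] with p h1 h2 using ⟨h1, h2⟩

end

/-- Lower bound for the derivatives of `x⁴ + x²y³ + a y^(j+3) / (j+3) + …`. The second scale
`w = |y|^(m/n)` satisfies `w² = |y|^j`. -/
theorem exists_lower_bound_W {m n j : ℕ} (hm : 0 < m) (hn : 0 < n) (hmn : 2 * m = n * j)
    (hj : 4 ≤ j) {a b : ℂ} (ha : a ≠ 0) (t₀ : ℂ) :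
    ∃ c > 0, ∀ᶠ p in puncturedNhds t₀,
      c * ((gauge m n p ^ m) ^ 2 * ((gauge m n p ^ m) ^ 2 + ‖p.2‖ ^ 3)) ≤
        gauge m n p ^ m * ‖4 * p.2.1 ^ 3 + 2 * p.2.1 * p.2.2 ^ 3‖ +
        ‖p.2‖ * ‖3 * p.2.1 ^ 2 * p.2.2 ^ 2 + (a + b * p.1 * p.2.2) * p.2.2 ^ (j + 2)‖ := by
  have ha' := norm_pos_iff.2 ha
  obtain ⟨c, hc, κ, hκ, hlow⟩ := exists_lower_bound_quartic (half_pos ha') (mul_pos two_pos ha')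
  refine ⟨c, hc, ?_⟩
  filter_upwards [eventually_norm_add_mul (b := b) ha, eventually_norm_lt_puncturedNhds one_pos,
    eventually_norm_lt_puncturedNhds hκ] with p ⟨he1, he2⟩ hp1 hpκ
  set e := a + b * p.1 * p.2.2
  have hx1 : ‖p.2.1‖ ≤ 1 := (norm_fst_le p.2).trans hp1.le
  have hy1 : ‖p.2.2‖ ≤ 1 := (norm_snd_le p.2).trans hp1.le
  have hyκ : ‖p.2.2‖ ≤ κ := (norm_snd_le p.2).trans hpκ.le
  set w := (‖p.2.2‖ ^ (n : ℝ)⁻¹) ^ m with hw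
  have hw2 : w ^ 2 = ‖p.2.2‖ ^ j := by
    rw [hw, ← pow_mul, mul_comm m 2, hmn, pow_mul,
      Real.rpow_inv_natCast_pow (norm_nonneg _) hn.ne']
  have hwβ : w ^ 2 ≤ κ * ‖p.2.2‖ ^ 3 := by
    rw [hw2]
    calc ‖p.2.2‖ ^ j ≤ ‖p.2.2‖ ^ 4 := pow_le_pow_of_le_one (norm_nonneg _) hy1 hj
      _ = ‖p.2.2‖ * ‖p.2.2‖ ^ 3 := by ring
      _ ≤ _ := by gcongr
  have hE : ‖e * p.2.2 ^ j‖ = ‖e‖ * w ^ 2 := by rw [norm_mul, norm_pow, hw2]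
  have n1 : ‖4 * p.2.1 ^ 2‖ = 4 * ‖p.2.1‖ ^ 2 := by simp
  have n2 : ‖2 * p.2.2 ^ 3‖ = 2 * ‖p.2.2‖ ^ 3 := by simp
  have n3 : ‖3 * p.2.1 ^ 2‖ = 3 * ‖p.2.1‖ ^ 2 := by simp
  have i1 := norm_sub_le_norm_add (4 * p.2.1 ^ 2) (2 * p.2.2 ^ 3)
  have i2 := norm_sub_le_norm_add (2 * p.2.2 ^ 3) (4 * p.2.1 ^ 2)
  have i3 := norm_sub_le_norm_add (3 * p.2.1 ^ 2) (e * p.2.2 ^ j)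
  have i4 := norm_sub_le_norm_add (e * p.2.2 ^ j) (3 * p.2.1 ^ 2)
  rw [add_comm] at i2 i4
  rw [n1, n2] at i1 i2
  rw [n3, hE] at i3 i4
  have l1 : ‖e‖ * w ^ 2 ≤ 2 * ‖a‖ * w ^ 2 := by gcongr
  have l2 : ‖a‖ / 2 * w ^ 2 ≤ ‖e‖ * w ^ 2 := by gcongr
  have := hlow ‖p.2.1‖ ‖p.2.2‖ w ‖4 * p.2.1 ^ 2 + 2 * p.2.2 ^ 3‖ ‖3 * p.2.1 ^ 2 + e * p.2.2 ^ j‖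
    (norm_nonneg _) (norm_nonneg _) (by positivity) hx1 hwβ (norm_nonneg _) (norm_nonneg _)
    i1 i2 (by linarith) (by linarith)
  rw [show 4 * p.2.1 ^ 3 + 2 * p.2.1 * p.2.2 ^ 3 = p.2.1 * (4 * p.2.1 ^ 2 + 2 * p.2.2 ^ 3) by ring,
    show 3 * p.2.1 ^ 2 * p.2.2 ^ 2 + e * p.2.2 ^ (j + 2) =
      p.2.2 ^ 2 * (3 * p.2.1 ^ 2 + e * p.2.2 ^ j) by ring,
    gauge_pow_eq hm, ← hw, Prod.norm_def, norm_mul, norm_mul, norm_pow]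
  exact this

/-- Lower bound for the derivatives of `x³y + x²y³ + a y⁸ / 8 + …`. The second scale `w = |y|^(5/2)`
satisfies `w² = |y|⁵`. -/
theorem exists_lower_bound_Z_1_1 {a b : ℂ} (ha : a ≠ 0) (t₀ : ℂ) :
    ∃ c > 0, ∀ᶠ p in puncturedNhds t₀,
      c * ((gauge 5 2 p ^ 5) ^ 2 * ‖p.2‖ * (gauge 5 2 p ^ 5 + ‖p.2‖ ^ 2)) ≤
        gauge 5 2 p ^ 5 * ‖3 * p.2.1 ^ 2 * p.2.2 + 2 * p.2.1 * p.2.2 ^ 3‖ +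
        ‖p.2‖ * ‖p.2.1 ^ 3 + 3 * p.2.1 ^ 2 * p.2.2 ^ 2 +
          (a + b * p.1 * p.2.2) * p.2.2 ^ 7‖ := by
  have ha' := norm_pos_iff.2 ha
  obtain ⟨c, hc, κ, hκ, hlow⟩ := exists_lower_bound_cubic (half_pos ha') (mul_pos two_pos ha')
  refine ⟨c, hc, ?_⟩
  filter_upwards [eventually_norm_add_mul (b := b) ha,
    eventually_norm_lt_puncturedNhds (show (0 : ℝ) < 1 / 8 by norm_num),
    eventually_norm_lt_puncturedNhds (show 0 < κ ^ 2 by positivity)] with p ⟨he1, he2⟩ hp1 hpκ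
  set e := a + b * p.1 * p.2.2
  have hx1 : ‖p.2.1‖ ≤ 1 / 8 := (norm_fst_le p.2).trans hp1.le
  have hy1 : ‖p.2.2‖ ≤ 1 / 8 := (norm_snd_le p.2).trans hp1.le
  have hyκ : ‖p.2.2‖ ≤ κ ^ 2 := (norm_snd_le p.2).trans hpκ.le
  set w := (‖p.2.2‖ ^ ((2 : ℕ) : ℝ)⁻¹) ^ 5 with hw
  have hw2 : w ^ 2 = ‖p.2.2‖ ^ 5 := by
    rw [hw, ← pow_mul, mul_comm 5 2, pow_mul,
      Real.rpow_inv_natCast_pow (norm_nonneg _) two_ne_zero]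
  have hw0 : 0 ≤ w := by positivity
  have hwβ : w ≤ κ * ‖p.2.2‖ ^ 2 := by
    refine (sq_le_sq₀ hw0 (by positivity)).1 ?_
    calc w ^ 2 = ‖p.2.2‖ * ‖p.2.2‖ ^ 4 := by rw [hw2]; ring
      _ ≤ κ ^ 2 * ‖p.2.2‖ ^ 4 := by gcongr
      _ = _ := by ring
  have hE : ‖e * p.2.2 ^ 7‖ = ‖e‖ * (w ^ 2 * ‖p.2.2‖ ^ 2) := by
    rw [norm_mul, norm_pow, hw2]; ring
  have hxQ : ‖p.2.1 ^ 2 * (p.2.1 + 3 * p.2.2 ^ 2)‖ =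
      ‖p.2.1‖ ^ 2 * ‖p.2.1 + 3 * p.2.2 ^ 2‖ := by rw [norm_mul, norm_pow]
  have n1 : ‖3 * p.2.1‖ = 3 * ‖p.2.1‖ := by simp
  have n2 : ‖2 * p.2.2 ^ 2‖ = 2 * ‖p.2.2‖ ^ 2 := by simp
  have n3 : ‖3 * p.2.2 ^ 2‖ = 3 * ‖p.2.2‖ ^ 2 := by simp
  -- `x` and `y²` are combinations of `3x + 2y²` and `x + 3y²`
  have i1 : 7 * ‖p.2.1‖ ≤ 3 * ‖3 * p.2.1 + 2 * p.2.2 ^ 2‖ + 2 * ‖p.2.1 + 3 * p.2.2 ^ 2‖ := by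
    have := norm_sub_le (3 * (3 * p.2.1 + 2 * p.2.2 ^ 2)) (2 * (p.2.1 + 3 * p.2.2 ^ 2))
    rw [show 3 * (3 * p.2.1 + 2 * p.2.2 ^ 2) - 2 * (p.2.1 + 3 * p.2.2 ^ 2) = 7 * p.2.1 by ring,
      norm_mul, norm_mul, norm_mul] at this
    simpa using this
  have i2 : 7 * ‖p.2.2‖ ^ 2 ≤ ‖3 * p.2.1 + 2 * p.2.2 ^ 2‖ + 3 * ‖p.2.1 + 3 * p.2.2 ^ 2‖ := by
    have := norm_sub_le (3 * (p.2.1 + 3 * p.2.2 ^ 2)) (3 * p.2.1 + 2 * p.2.2 ^ 2)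
    rw [show 3 * (p.2.1 + 3 * p.2.2 ^ 2) - (3 * p.2.1 + 2 * p.2.2 ^ 2) = 7 * p.2.2 ^ 2 by ring,
      norm_mul, norm_mul, norm_pow, add_comm] at this
    simpa using this
  have i3 := norm_sub_le_norm_add (2 * p.2.2 ^ 2) (3 * p.2.1)
  have i4 := norm_sub_le_norm_add p.2.1 (3 * p.2.2 ^ 2)
  have i5 := norm_add_le p.2.1 (3 * p.2.2 ^ 2)
  have i6 := norm_sub_le_norm_add (p.2.1 ^ 2 * (p.2.1 + 3 * p.2.2 ^ 2)) (e * p.2.2 ^ 7)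
  have i7 := norm_sub_le_norm_add (e * p.2.2 ^ 7) (p.2.1 ^ 2 * (p.2.1 + 3 * p.2.2 ^ 2))
  rw [add_comm, n1, n2] at i3
  rw [n3] at i4 i5
  rw [add_comm (e * _)] at i7
  rw [hxQ, hE] at i6 i7
  have l1 : ‖e‖ * (w ^ 2 * ‖p.2.2‖ ^ 2) ≤ 2 * ‖a‖ * (w ^ 2 * ‖p.2.2‖ ^ 2) := by gcongr
  have l2 : ‖a‖ / 2 * (w ^ 2 * ‖p.2.2‖ ^ 2) ≤ ‖e‖ * (w ^ 2 * ‖p.2.2‖ ^ 2) := by gcongr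
  have := hlow ‖p.2.1‖ ‖p.2.2‖ w ‖3 * p.2.1 + 2 * p.2.2 ^ 2‖ ‖p.2.1 + 3 * p.2.2 ^ 2‖
    ‖p.2.1 ^ 2 * (p.2.1 + 3 * p.2.2 ^ 2) + e * p.2.2 ^ 7‖
    (norm_nonneg _) (norm_nonneg _) hw0 (hx1.trans (by norm_num)) hy1 hwβ (norm_nonneg _)
    (norm_nonneg _) i1 i2 (by linarith) i4 i5 (by linarith) (by linarith)
  rw [show 3 * p.2.1 ^ 2 * p.2.2 + 2 * p.2.1 * p.2.2 ^ 3 =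
      p.2.1 * p.2.2 * (3 * p.2.1 + 2 * p.2.2 ^ 2) by ring,
    show p.2.1 ^ 3 + 3 * p.2.1 ^ 2 * p.2.2 ^ 2 = p.2.1 ^ 2 * (p.2.1 + 3 * p.2.2 ^ 2) by ring,
    gauge_pow_eq (by norm_num), ← hw, Prod.norm_def, norm_mul, norm_mul]
  exact this

theorem isLipschitzTrivial_W_1_1 {s : ℂ} (hs : s ≠ 0) : IsLipschitzTrivial (W_1_1 s) := by
  refine isLipschitzTrivial_of_two_scales (m := 2) (n := 1)
    (μ := fun X Y => X ^ 2 * (X ^ 2 + Y ^ 3)) (A₀ := fun _ => 0) (B₀ := fun _ => 0)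
    (ft := fun p => p.2.2 ^ 8) (fx := fun p => 4 * p.2.1 ^ 3 + 2 * p.2.1 * p.2.2 ^ 3)
    (fy := fun p => 3 * p.2.1 ^ 2 * p.2.2 ^ 2 + (7 * s + 8 * p.1 * p.2.2) * p.2.2 ^ (4 + 2))
    ?_ (by simp) one_pos one_le_two contDiff_const contDiff_const (fun _ => rfl) (fun _ => rfl)
    (fun X Y hX hY => by positivity) fun t₀ => ?_
  · intro T X Y T' X' Y' S τ hT hX hY
    refine ((((hX.pow 4).add ((hX.pow 2).mul (hY.pow 3))).add ((hY.pow 7).const_mul s)).add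
      (hT.mul (hY.pow 8))).congr_deriv ?_
    simp
    ring
  have mono := @Controlled.mixed_monomial 2 1 t₀ (fun X Y => X ^ 2 * (X ^ 2 + Y ^ 3))
    (by norm_num) (by norm_num)
  have mono' := @Controlled.mixed_monomial 2 1 t₀ (fun X Y => X ^ 2 * (X ^ 2 + Y ^ 3) * X)
    (by norm_num) (by norm_num)
  refine ⟨?_, ?_, ?_, ?_, ?_⟩
  · refine ((mono 4 0 1 0 3 0 ?_).add
      (mono 2 0 1 0 1 3 ?_)).congr fun p => by ring
    · intro X Y hX hXY hY h
      have hY0 := hX.trans hXY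
      have : 0 ≤ X ^ 2 * Y ^ 3 := by positivity
      simp only [Nat.reduceAdd]
      linarith
    · intro X Y hX hXY hY h
      have : 0 ≤ X ^ 4 := by positivity
      simp only [Nat.reduceAdd]
      linarith
  · have key : ∀ X Y : ℝ, 0 ≤ X → X ≤ Y → Y ≤ 1 → Y ^ 2 ≤ X ^ 1 →
        Y ^ 7 ≤ X ^ 2 * (X ^ 2 + Y ^ 3) := by
      intro X Y hX hXY hY h
      have hY0 := hX.trans hXY
      have h0 : 0 ≤ X ^ 4 := by positivity
      have h1 : (Y ^ 2) ^ 2 * Y ^ 3 ≤ (X ^ 1) ^ 2 * Y ^ 3 := by gcongr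
      linarith
    refine (((mono 3 0 0 1 2 2 ?_).add
      (mono (7 * s) 0 0 1 0 6 ?_)).add
      (mono 8 1 0 1 0 7 ?_)).congr fun p => by ring
    · intro X Y hX hXY hY h
      have : 0 ≤ X ^ 4 := by positivity
      simp only [Nat.reduceAdd]
      linarith
    · intro X Y hX hXY hY h
      simpa using key X Y hX hXY hY h
    · intro X Y hX hXY hY h
      refine le_trans ?_ (key X Y hX hXY hY h)
      simpa using pow_le_pow_of_le_one (hX.trans hXY) hY (show 7 ≤ 8 by norm_num)
  · exact exists_lower_bound_W two_pos one_pos rfl le_rfl (mul_ne_zero (by norm_num) hs) t₀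
  · refine (mono' 1 0 1 0 0 8 ?_).congr fun p => by ring
    intro X Y hX hXY hY h
    have hY0 := hX.trans hXY
    calc X ^ (1 + 0) * Y ^ (0 + 8) = (Y ^ 2) ^ 2 * (Y ^ 3 * Y) * X := by ring
      _ ≤ (X ^ 1) ^ 2 * (Y ^ 3 * 1) * X := by gcongr
      _ = X ^ 2 * (0 + Y ^ 3) * X := by ring
      _ ≤ _ := by gcongr; positivity
  · refine (mono' 1 0 0 1 0 8 ?_).congr fun p => by ring
    intro X Y hX hXY hY h
    have hY0 := hX.trans hXY
    calc X ^ (0 + 0) * Y ^ (1 + 8) = (Y ^ 2) ^ 3 * Y ^ 3 := by ring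
      _ ≤ (X ^ 1) ^ 3 * Y ^ 3 := by gcongr
      _ = X ^ 2 * (0 + Y ^ 3) * X := by ring
      _ ≤ _ := by gcongr; positivity

/-- For the scales of `W_1_2` and `Z_1_1`, `Y⁸ ≤ X³`. -/
theorem pow_eight_le_cube {X Y : ℝ} (hX : 0 ≤ X) (hXY : X ≤ Y) (hY : Y ≤ 1)
    (h : Y ^ 5 ≤ X ^ 2) : Y ^ 8 ≤ X ^ 3 := by
  have hY0 := hX.trans hXY
  refine (sq_le_sq₀ (by positivity) (by positivity)).1 ?_
  calc (Y ^ 8) ^ 2 = (Y ^ 5) ^ 3 * Y := by ring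
    _ ≤ (X ^ 2) ^ 3 * 1 := by gcongr
    _ = _ := by ring

theorem isLipschitzTrivial_W_1_2 {s : ℂ} (hs : s ≠ 0) : IsLipschitzTrivial (W_1_2 s) := by
  -- `a (-3/2 x y ∂x + y² ∂y)` annihilates `x²y³` and maps `s y⁸` to `-y⁹`
  obtain ⟨a, ha⟩ : ∃ a : ℂ, 8 * a * s = -1 := ⟨-1 / (8 * s), by field_simp⟩
  refine isLipschitzTrivial_of_two_scales (m := 5) (n := 2)
    (μ := fun X Y => X ^ 2 * (X ^ 2 + Y ^ 3)) (A₀ := fun p => -(3 / 2) * a * p.2.1 * p.2.2)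
    (B₀ := fun p => a * p.2.2 ^ 2)
    (ft := fun p => p.2.2 ^ 9) (fx := fun p => 4 * p.2.1 ^ 3 + 2 * p.2.1 * p.2.2 ^ 3)
    (fy := fun p => 3 * p.2.1 ^ 2 * p.2.2 ^ 2 + (8 * s + 9 * p.1 * p.2.2) * p.2.2 ^ (5 + 2))
    ?_ (by simp) two_pos (by norm_num) (by fun_prop) (by fun_prop) (by simp) (by simp)
    (fun X Y hX hY => by positivity) fun t₀ => ?_
  · intro T X Y T' X' Y' S τ hT hX hY
    refine ((((hX.pow 4).add ((hX.pow 2).mul (hY.pow 3))).add ((hY.pow 8).const_mul s)).add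
      (hT.mul (hY.pow 9))).congr_deriv ?_
    simp
    ring
  have mono := @Controlled.mixed_monomial 5 2 t₀ (fun X Y => X ^ 2 * (X ^ 2 + Y ^ 3))
    (by norm_num) (by norm_num)
  have mono' := @Controlled.mixed_monomial 5 2 t₀ (fun X Y => X ^ 2 * (X ^ 2 + Y ^ 3) * X)
    (by norm_num) (by norm_num)
  refine ⟨?_, ?_, ?_, ?_, ?_⟩
  · refine ((mono 4 0 1 0 3 0 ?_).add
      (mono 2 0 1 0 1 3 ?_)).congr fun p => by ring
    · intro X Y hX hXY hY h
      have hY0 := hX.trans hXY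
      have : 0 ≤ X ^ 2 * Y ^ 3 := by positivity
      simp only [Nat.reduceAdd]
      linarith
    · intro X Y hX hXY hY h
      have : 0 ≤ X ^ 4 := by positivity
      simp only [Nat.reduceAdd]
      linarith
  · have key : ∀ X Y : ℝ, 0 ≤ X → X ≤ Y → Y ≤ 1 → Y ^ 5 ≤ X ^ 2 →
        Y ^ 8 ≤ X ^ 2 * (X ^ 2 + Y ^ 3) := by
      intro X Y hX hXY hY h
      have hY0 := hX.trans hXY
      have h0 : 0 ≤ X ^ 4 := by positivity
      have h1 : Y ^ 5 * Y ^ 3 ≤ X ^ 2 * Y ^ 3 := by gcongr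
      linarith
    refine (((mono 3 0 0 1 2 2 ?_).add
      (mono (8 * s) 0 0 1 0 7 ?_)).add
      (mono 9 1 0 1 0 8 ?_)).congr fun p => by ring
    · intro X Y hX hXY hY h
      have : 0 ≤ X ^ 4 := by positivity
      simp only [Nat.reduceAdd]
      linarith
    · intro X Y hX hXY hY h
      simpa using key X Y hX hXY hY h
    · intro X Y hX hXY hY h
      refine le_trans ?_ (key X Y hX hXY hY h)
      simpa using pow_le_pow_of_le_one (hX.trans hXY) hY (show 8 ≤ 9 by norm_num)
  · exact exists_lower_bound_W (by norm_num) two_pos rfl (by norm_num)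
      (mul_ne_zero (by norm_num) hs) t₀
  · refine ((mono' (-6 * a) 0 1 0 4 1 ?_).add (mono' (9 * a) 1 1 0 0 10 ?_)).congr fun p => by
        linear_combination -p.2.2 ^ 9 * (gauge 5 2 p : ℂ) ^ 5 * ha
    · intro X Y hX hXY hY h
      have hY0 := hX.trans hXY
      calc X ^ (1 + 4) * Y ^ (0 + 1) ≤ X ^ 5 * 1 := by gcongr; simpa using hY
        _ = X ^ 2 * (X ^ 2 + 0) * X := by ring
        _ ≤ _ := by gcongr; positivity
    · intro X Y hX hXY hY h
      have hY0 := hX.trans hXY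
      calc X ^ (1 + 0) * Y ^ (0 + 10) = Y ^ 5 * (Y ^ 3 * Y ^ 2) * X := by ring
        _ ≤ X ^ 2 * (Y ^ 3 * 1) * X := by gcongr; exact pow_le_one₀ hY0 hY
        _ = X ^ 2 * (0 + Y ^ 3) * X := by ring
        _ ≤ _ := by gcongr; positivity
  · refine ((mono' (-6 * a) 0 0 1 4 1 ?_).add (mono' (9 * a) 1 0 1 0 10 ?_)).congr fun p => by
        linear_combination -p.2.2 ^ 9 * (‖p.2‖ : ℂ) * ha
    · intro X Y hX hXY hY h
      have hY0 := hX.trans hXY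
      calc X ^ (0 + 4) * Y ^ (1 + 1) = X ^ 2 * (X * Y ^ 2) * X := by ring
        _ ≤ X ^ 2 * (Y * Y ^ 2) * X := by gcongr
        _ = X ^ 2 * (0 + Y ^ 3) * X := by ring
        _ ≤ _ := by gcongr; positivity
    · intro X Y hX hXY hY h
      have hY0 := hX.trans hXY
      calc X ^ (0 + 0) * Y ^ (1 + 10) = Y ^ 8 * Y ^ 3 := by ring
        _ ≤ X ^ 3 * Y ^ 3 := by gcongr; exact pow_eight_le_cube hX hXY hY h
        _ = X ^ 2 * (0 + Y ^ 3) * X := by ring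
        _ ≤ _ := by gcongr; positivity

theorem isLipschitzTrivial_Z_1_1 {s : ℂ} (hs : s ≠ 0) : IsLipschitzTrivial (Z_1_1 s) := by
  -- `a (-3/2 x y ∂x + y² ∂y)` annihilates `x²y³` and maps `s y⁸` to `-y⁹`
  obtain ⟨a, ha⟩ : ∃ a : ℂ, 8 * a * s = -1 := ⟨-1 / (8 * s), by field_simp⟩
  refine isLipschitzTrivial_of_two_scales (m := 5) (n := 2)
    (μ := fun X Y => X ^ 2 * Y * (X + Y ^ 2)) (A₀ := fun p => -(3 / 2) * a * p.2.1 * p.2.2)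
    (B₀ := fun p => a * p.2.2 ^ 2)
    (ft := fun p => p.2.2 ^ 9) (fx := fun p => 3 * p.2.1 ^ 2 * p.2.2 + 2 * p.2.1 * p.2.2 ^ 3)
    (fy := fun p => p.2.1 ^ 3 + 3 * p.2.1 ^ 2 * p.2.2 ^ 2 +
      (8 * s + 9 * p.1 * p.2.2) * p.2.2 ^ 7)
    ?_ (by simp) two_pos (by norm_num) (by fun_prop) (by fun_prop) (by simp) (by simp)
    (fun X Y hX hY => by positivity) fun t₀ => ?_
  · intro T X Y T' X' Y' S τ hT hX hY
    refine (((((hX.pow 3).mul hY).add ((hX.pow 2).mul (hY.pow 3))).add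
      ((hY.pow 8).const_mul s)).add (hT.mul (hY.pow 9))).congr_deriv ?_
    simp
    ring
  have mono := @Controlled.mixed_monomial 5 2 t₀ (fun X Y => X ^ 2 * Y * (X + Y ^ 2))
    (by norm_num) (by norm_num)
  have mono' := @Controlled.mixed_monomial 5 2 t₀ (fun X Y => X ^ 2 * Y * (X + Y ^ 2) * X)
    (by norm_num) (by norm_num)
  refine ⟨?_, ?_, ?_, ?_, ?_⟩
  · refine ((mono 3 0 1 0 2 1 ?_).add
      (mono 2 0 1 0 1 3 ?_)).congr fun p => by ring
    · intro X Y hX hXY hY h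
      have hY0 := hX.trans hXY
      have : 0 ≤ X ^ 2 * Y ^ 3 := by positivity
      simp only [Nat.reduceAdd]
      linarith
    · intro X Y hX hXY hY h
      have hY0 := hX.trans hXY
      have : 0 ≤ X ^ 3 * Y := by positivity
      simp only [Nat.reduceAdd]
      linarith
  · have key : ∀ X Y : ℝ, 0 ≤ X → X ≤ Y → Y ≤ 1 → Y ^ 5 ≤ X ^ 2 →
        Y ^ 8 ≤ X ^ 2 * Y * (X + Y ^ 2) := by
      intro X Y hX hXY hY h
      have hY0 := hX.trans hXY
      have h0 : 0 ≤ X ^ 3 * Y := by positivity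
      have h1 : Y ^ 5 * Y ^ 3 ≤ X ^ 2 * Y ^ 3 := by gcongr
      linarith
    refine ((((mono 1 0 0 1 3 0 ?_).add
      (mono 3 0 0 1 2 2 ?_)).add
      (mono (8 * s) 0 0 1 0 7 ?_)).add
      (mono 9 1 0 1 0 8 ?_)).congr fun p => by ring
    · intro X Y hX hXY hY h
      have hY0 := hX.trans hXY
      have : 0 ≤ X ^ 2 * Y ^ 3 := by positivity
      simp only [Nat.reduceAdd]
      linarith
    · intro X Y hX hXY hY h
      have hY0 := hX.trans hXY
      have : 0 ≤ X ^ 3 * Y := by positivity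
      simp only [Nat.reduceAdd]
      linarith
    · intro X Y hX hXY hY h
      simpa using key X Y hX hXY hY h
    · intro X Y hX hXY hY h
      refine le_trans ?_ (key X Y hX hXY hY h)
      simpa using pow_le_pow_of_le_one (hX.trans hXY) hY (show 8 ≤ 9 by norm_num)
  · exact exists_lower_bound_Z_1_1 (mul_ne_zero (by norm_num) hs) t₀
  · refine ((mono' (-(7 / 2) * a) 0 1 0 3 2 ?_).add (mono' (9 * a) 1 1 0 0 10 ?_)).congr fun p => by
        linear_combination -p.2.2 ^ 9 * (gauge 5 2 p : ℂ) ^ 5 * ha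
    · intro X Y hX hXY hY h
      have hY0 := hX.trans hXY
      calc X ^ (1 + 3) * Y ^ (0 + 2) = X ^ 2 * Y * (X * Y) * X := by ring
        _ ≤ X ^ 2 * Y * (X * 1) * X := by gcongr
        _ = X ^ 2 * Y * (X + 0) * X := by ring
        _ ≤ _ := by gcongr; positivity
    · intro X Y hX hXY hY h
      have hY0 := hX.trans hXY
      calc X ^ (1 + 0) * Y ^ (0 + 10) = Y ^ 5 * Y * (Y ^ 2 * Y ^ 2) * X := by ring
        _ ≤ X ^ 2 * Y * (Y ^ 2 * 1) * X := by gcongr; exact pow_le_one₀ hY0 hY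
        _ = X ^ 2 * Y * (0 + Y ^ 2) * X := by ring
        _ ≤ _ := by gcongr
  · refine ((mono' (-(7 / 2) * a) 0 0 1 3 2 ?_).add (mono' (9 * a) 1 0 1 0 10 ?_)).congr fun p => by
        linear_combination -p.2.2 ^ 9 * (‖p.2‖ : ℂ) * ha
    · intro X Y hX hXY hY h
      have hY0 := hX.trans hXY
      calc X ^ (0 + 3) * Y ^ (1 + 2) = X ^ 2 * Y * (0 + Y ^ 2) * X := by ring
        _ ≤ _ := by gcongr
    · intro X Y hX hXY hY h
      have hY0 := hX.trans hXY
      calc X ^ (0 + 0) * Y ^ (1 + 10) = Y ^ 8 * Y ^ 3 := by ring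
        _ ≤ X ^ 3 * Y ^ 3 := by gcongr; exact pow_eight_le_cube hX hXY hY h
        _ = X ^ 2 * Y * (0 + Y ^ 2) * X := by ring
        _ ≤ _ := by gcongr

end LipschitzTriviality

theorem mainTheorem6 :
    (∀ s : ℂ, 4 * s ^ 3 + 27 ≠ 0 →
      LipschitzTriviality.IsLipschitzTrivial (LipschitzTriviality.Z_1_0 s)) ∧
    (∀ s : ℂ, s ≠ 0 →
      LipschitzTriviality.IsLipschitzTrivial (LipschitzTriviality.Z_1_1 s)) ∧
    (∀ s : ℂ, s ≠ 0 →
      LipschitzTriviality.IsLipschitzTrivial (LipschitzTriviality.Z_17 s)) ∧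
    (∀ s : ℂ, s ^ 2 ≠ 4 →
      LipschitzTriviality.IsLipschitzTrivial (LipschitzTriviality.W_1_0 s)) ∧
    (∀ s : ℂ, s ≠ 0 →
      LipschitzTriviality.IsLipschitzTrivial (LipschitzTriviality.W_1_1 s)) ∧
    (∀ s : ℂ, s ≠ 0 →
      LipschitzTriviality.IsLipschitzTrivial (LipschitzTriviality.W_1_2 s)) ∧
    (∀ s : ℂ, s ≠ 0 →
      LipschitzTriviality.IsLipschitzTrivial (LipschitzTriviality.W_17 s)) ∧
    (∀ s : ℂ, s ≠ 0 →
      LipschitzTriviality.IsLipschitzTrivial (LipschitzTriviality.W_18 s)) ∧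
    (∀ q : ℕ, 0 < q → ∀ s : ℂ, s ≠ 0 →
      LipschitzTriviality.IsLipschitzTrivial (LipschitzTriviality.W_sharp_odd q s)) ∧
    (∀ q : ℕ, 0 < q → ∀ s : ℂ, s ≠ 0 →
      LipschitzTriviality.IsLipschitzTrivial (LipschitzTriviality.W_sharp_even q s)) := by
  open LipschitzTriviality in
  exact ⟨fun _ hs => isLipschitzTrivial_Z_1_0 hs, fun _ hs => isLipschitzTrivial_Z_1_1 hs,
    fun s _ => isLipschitzTrivial_Z_17 s, fun _ hs => isLipschitzTrivial_W_1_0 hs,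
    fun _ hs => isLipschitzTrivial_W_1_1 hs, fun _ hs => isLipschitzTrivial_W_1_2 hs,
    fun s _ => isLipschitzTrivial_W_17 s, fun s _ => isLipschitzTrivial_W_18 s,
    fun _ hq _ hs => isLipschitzTrivial_W_sharp_odd hq hs,
    fun _ hq _ hs => isLipschitzTrivial_W_sharp_even hq hs⟩
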